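/- Let $\mathbb D=\{x\in\mathbb R^2:|x|<1\}$ be the open unit disk with boundary circle $\Sigma$ and outer unit normal $\nu$, and let $V$ be a real-valued potential in $C_c^\infty([0,\infty))$ (smooth up to $t=0$). Assume that (i) $V$ is resonant: the problem $-\psi''+V\psi=0$ on $(0,\infty)$, $\psi(0)=0$, has a bounded non-trivial solution $\psi\in C^\infty([0,\infty))$; (ii) the self-adjoint operator $f\mapsto -f''+Vf$ in $L^2((0,\infty))$ with domain $H^1_0((0,\infty))\cap H^2((0,\infty))$ has at least one negative eigenvalue. For $\varepsilon>0$ let $A_\varepsilon$ be the self-adjoint operator in $L^2(\mathbb D)$ $$A_\varepsilon u=-\Delta u+\frac1{\varepsilon^2}V\Bigl(\frac{\operatorname{dist}(\cdot,\Sigma)}{\varepsilon}\Bigr)u,\qquad \operatorname{dom}A_\varepsilon=H^1_0(\mathbb D)\cap H^2(\mathbb D),$$ and let $A$ be the self-adjoint Robin Laplacian in $L^2(\mathbb D)$ $$Au=-\Delta u,\qquad \operatorname{dom}A=\Bigl\{u\in H^2(\mathbb D):\ \partial_\nu u|_\Sigma+\tfrac{d-1}{2}\,H\,u|_\Sigma=0\Bigr\},$$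 where $d=2$ and $H$ is the mean curvature of $\Sigma$ (so $H\equiv1$, and the condition reads $\partial_\nu u+\tfrac12u=0$ on $\Sigma$). Then $A_\varepsilon$ does not converge to $A$ in norm resolvent sense as $\varepsilon\to0^+$; that is, the operator norm $\|(A_\varepsilon-i)^{-1}-(A-i)^{-1}\|$ does not tend to $0$ as $\varepsilon\to0^+$. -/

import Mathlib

open MeasureTheory Set Filter Topology TopologicalSpace Metric
open scoped ENNReal ContDiff Distributions InnerProductSpace

noncomputable section

/-! ### Complex `L²`-based Sobolev spaces on an open set

`Ω` is an open subset of a finite-dimensional real inner product space `E`, and `e : ι → E` is the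
orthonormal frame in whose directions partial derivatives are taken (the standard basis of `ℝ²`, or
the vector `1` of `ℝ`). -/

section Sobolev

variable {E : Type*} [NormedAddCommGroup E] [InnerProductSpace ℝ E] [FiniteDimensional ℝ E]
  [MeasurableSpace E] [BorelSpace E]

/-- The Hilbert space `L²(Ω; ℂ)` with respect to Lebesgue measure. -/
abbrev L2 (Ω : Opens E) : Type _ := Lp ℂ 2 (volume.restrict (Ω : Set E))

/-- `v` is the weak derivative of `u` on `Ω` in the direction `a`. -/
def HasWeakDeriv (Ω : Opens E) (a : E) (u v : L2 Ω) : Prop :=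
  ∀ φ : 𝓓(Ω, ℂ), ∫ x in (Ω : Set E), u x * fderiv ℝ φ x a = -∫ x in (Ω : Set E), v x * φ x

lemma integrable_L2_mul {Ω : Opens E} (u : L2 Ω) {g : E → ℂ} (hg : Continuous g)
    (hs : HasCompactSupport g) :
    Integrable (fun x => u x * g x) (volume.restrict (Ω : Set E)) :=
  MemLp.integrable_mul (p := 2) (q := 2) (Lp.memLp u) (hg.memLp_of_hasCompactSupport hs)

lemma integrable_L2_mul_test {Ω : Opens E} (u : L2 Ω) (φ : 𝓓(Ω, ℂ)) :
    Integrable (fun x => u x * φ x) (volume.restrict (Ω : Set E)) :=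
  integrable_L2_mul u φ.continuous φ.hasCompactSupport

lemma integrable_L2_mul_fderiv_test {Ω : Opens E} (u : L2 Ω) (φ : 𝓓(Ω, ℂ)) (a : E) :
    Integrable (fun x => u x * fderiv ℝ φ x a) (volume.restrict (Ω : Set E)) :=
  integrable_L2_mul u ((φ.contDiff.continuous_fderiv (by simp)).clm_apply continuous_const)
    (φ.hasCompactSupport.fderiv_apply ℝ a)

lemma HasWeakDeriv.add {Ω : Opens E} {a : E} {u₁ u₂ v₁ v₂ : L2 Ω}
    (h₁ : HasWeakDeriv Ω a u₁ v₁) (h₂ : HasWeakDeriv Ω a u₂ v₂) :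
    HasWeakDeriv Ω a (u₁ + u₂) (v₁ + v₂) := by
  intro φ
  have e₁ : ∫ x in (Ω : Set E), (u₁ + u₂ : L2 Ω) x * fderiv ℝ φ x a
      = ∫ x in (Ω : Set E), (u₁ x * fderiv ℝ φ x a + u₂ x * fderiv ℝ φ x a) := by
    refine integral_congr_ae ?_
    filter_upwards [Lp.coeFn_add u₁ u₂] with x hx
    rw [hx, Pi.add_apply, add_mul]
  have e₂ : ∫ x in (Ω : Set E), (v₁ + v₂ : L2 Ω) x * φ x
      = ∫ x in (Ω : Set E), (v₁ x * φ x + v₂ x * φ x) := by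
    refine integral_congr_ae ?_
    filter_upwards [Lp.coeFn_add v₁ v₂] with x hx
    rw [hx, Pi.add_apply, add_mul]
  rw [e₁, e₂, integral_add (integrable_L2_mul_fderiv_test u₁ φ a)
    (integrable_L2_mul_fderiv_test u₂ φ a), integral_add (integrable_L2_mul_test v₁ φ)
    (integrable_L2_mul_test v₂ φ), h₁ φ, h₂ φ]
  ring

lemma HasWeakDeriv.smul {Ω : Opens E} {a : E} {u v : L2 Ω} (c : ℂ)
    (h : HasWeakDeriv Ω a u v) : HasWeakDeriv Ω a (c • u) (c • v) := by
  intro φ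
  have e₁ : ∫ x in (Ω : Set E), (c • u : L2 Ω) x * fderiv ℝ φ x a
      = ∫ x in (Ω : Set E), c * (u x * fderiv ℝ φ x a) := by
    refine integral_congr_ae ?_
    filter_upwards [Lp.coeFn_smul c u] with x hx
    rw [hx, Pi.smul_apply, smul_eq_mul, mul_assoc]
  have e₂ : ∫ x in (Ω : Set E), (c • v : L2 Ω) x * φ x
      = ∫ x in (Ω : Set E), c * (v x * φ x) := by
    refine integral_congr_ae ?_
    filter_upwards [Lp.coeFn_smul c v] with x hx
    rw [hx, Pi.smul_apply, smul_eq_mul, mul_assoc]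
  rw [e₁, e₂, integral_const_mul, integral_const_mul, h φ]
  ring

lemma HasWeakDeriv.zero (Ω : Opens E) (a : E) : HasWeakDeriv Ω a 0 0 := by
  simpa using (show HasWeakDeriv Ω a ((0 : ℂ) • (0 : L2 Ω)) ((0 : ℂ) • (0 : L2 Ω)) by
    intro φ
    have e (g : E → ℂ) :
        ∫ x in (Ω : Set E), ((0 : ℂ) • (0 : L2 Ω) : L2 Ω) x * g x = 0 := by
      rw [zero_smul]
      refine integral_eq_zero_of_ae ?_
      filter_upwards [Lp.coeFn_zero ℂ 2 (volume.restrict (Ω : Set E))] with x hx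
      rw [hx]; simp
    rw [e, e, neg_zero])

/-- Weak derivatives are unique. -/
lemma HasWeakDeriv.unique {Ω : Opens E} {a : E} {u v w : L2 Ω}
    (hv : HasWeakDeriv Ω a u v) (hw : HasWeakDeriv Ω a u w) : v = w := by
  have hd : ∀ φ : 𝓓(Ω, ℂ), ∫ x in (Ω : Set E), (v x - w x) * φ x = 0 := by
    intro φ
    have : ∫ x in (Ω : Set E), v x * φ x = ∫ x in (Ω : Set E), w x * φ x :=
      neg_injective ((hv φ).symm.trans (hw φ))
    simp_rw [sub_mul]
    rw [integral_sub (integrable_L2_mul_test v φ) (integrable_L2_mul_test w φ), this, sub_self]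
  have hloc : LocallyIntegrableOn (fun x => v x - w x) (Ω : Set E) volume := by
    refine LocallyIntegrableOn.mono_set ?_ (subset_refl _)
    have hm : MemLp (fun x => v x - w x) 2 (volume.restrict (Ω : Set E)) :=
      (Lp.memLp v).sub (Lp.memLp w)
    intro x hx
    obtain ⟨K, hK, hKn⟩ := exists_compact_mem_nhds x
    refine ⟨K ∩ Ω, inter_mem (mem_nhdsWithin_of_mem_nhds hKn) self_mem_nhdsWithin, ?_⟩
    have hfin : IsFiniteMeasure (volume.restrict (K ∩ (Ω : Set E))) :=
      ⟨by
        rw [Measure.restrict_apply_univ]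
        exact (measure_mono inter_subset_left).trans_lt hK.measure_lt_top⟩
    exact (hm.mono_measure (Measure.restrict_mono inter_subset_right le_rfl)).integrable
      (by norm_num)
  have key := Ω.isOpen.ae_eq_zero_of_integral_contDiff_smul_eq_zero hloc (by
    intro g hg hgs hgΩ
    have hc : ContDiff ℝ ∞ (fun x => (g x : ℂ)) := Complex.ofRealCLM.contDiff.comp hg
    have ht : tsupport (fun x => (g x : ℂ)) ⊆ tsupport g :=
      closure_mono (fun x hx => by
        simp only [Function.mem_support, ne_eq, Complex.ofReal_eq_zero] at hx
        simpa using hx)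
    let φ : 𝓓(Ω, ℂ) := ⟨fun x => (g x : ℂ), hc,
      hgs.of_isClosed_subset (isClosed_tsupport _) ht, ht.trans hgΩ⟩
    have h0 := hd φ
    have hsub : ∫ x in (Ω : Set E), g x • (v x - w x) = ∫ x, g x • (v x - w x) := by
      refine setIntegral_eq_integral_of_forall_compl_eq_zero ?_
      intro x hx
      have : g x = 0 := by
        by_contra hne
        exact hx (hgΩ (subset_tsupport g hne))
      simp [this]
    rw [← hsub, ← h0]
    refine integral_congr_ae (Eventually.of_forall fun x => ?_)
    change g x • (v x - w x) = (v x - w x) * (g x : ℂ)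
    rw [Complex.real_smul, mul_comm])
  refine Lp.ext ?_
  filter_upwards [(ae_restrict_iff' Ω.isOpen.measurableSet).2 key] with x hx
  exact sub_eq_zero.1 hx

open Classical in
/-- The weak derivative of `u` in the direction `a` as an element of `L²(Ω)` (with the value `0` if
`u` has no weak derivative in `L²(Ω)`). -/
def weakDeriv (Ω : Opens E) (a : E) (u : L2 Ω) : L2 Ω :=
  if h : ∃ v, HasWeakDeriv Ω a u v then h.choose else 0

lemma weakDeriv_eq {Ω : Opens E} {a : E} {u v : L2 Ω} (h : HasWeakDeriv Ω a u v) :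
    weakDeriv Ω a u = v := by
  have hex : ∃ v, HasWeakDeriv Ω a u v := ⟨v, h⟩
  rw [weakDeriv, dif_pos hex]
  exact hex.choose_spec.unique h

variable {ι : Type*}

/-- The Sobolev space `H¹(Ω)`. -/
def sobolevH1 (Ω : Opens E) (e : ι → E) : Submodule ℂ (L2 Ω) where
  carrier := {u | ∀ i, ∃ v, HasWeakDeriv Ω (e i) u v}
  add_mem' := fun hu hv i =>
    ⟨_, (hu i).choose_spec.add (hv i).choose_spec⟩
  zero_mem' := fun _ => ⟨0, .zero Ω _⟩
  smul_mem' := fun c _ hu i => ⟨_, (hu i).choose_spec.smul c⟩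

lemma weakDeriv_add {Ω : Opens E} {e : ι → E} {u v : L2 Ω} (hu : u ∈ sobolevH1 Ω e)
    (hv : v ∈ sobolevH1 Ω e) (i : ι) :
    weakDeriv Ω (e i) (u + v) = weakDeriv Ω (e i) u + weakDeriv Ω (e i) v := by
  obtain ⟨p, hp⟩ := hu i
  obtain ⟨q, hq⟩ := hv i
  rw [weakDeriv_eq hp, weakDeriv_eq hq, weakDeriv_eq (hp.add hq)]

lemma weakDeriv_smul {Ω : Opens E} {e : ι → E} {u : L2 Ω} (c : ℂ) (hu : u ∈ sobolevH1 Ω e)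
    (i : ι) : weakDeriv Ω (e i) (c • u) = c • weakDeriv Ω (e i) u := by
  obtain ⟨p, hp⟩ := hu i
  rw [weakDeriv_eq hp, weakDeriv_eq (hp.smul c)]

lemma weakDeriv_zero (Ω : Opens E) (a : E) : weakDeriv Ω a 0 = 0 := weakDeriv_eq (.zero Ω a)

/-- The Sobolev space `H²(Ω)`. -/
def sobolevH2 (Ω : Opens E) (e : ι → E) : Submodule ℂ (L2 Ω) where
  carrier := {u | u ∈ sobolevH1 Ω e ∧ ∀ i, weakDeriv Ω (e i) u ∈ sobolevH1 Ω e}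
  add_mem' := by
    rintro u v ⟨hu, hu'⟩ ⟨hv, hv'⟩
    refine ⟨add_mem hu hv, fun i => ?_⟩
    rw [weakDeriv_add hu hv]
    exact add_mem (hu' i) (hv' i)
  zero_mem' := ⟨zero_mem _, fun i => by rw [weakDeriv_zero]; exact zero_mem _⟩
  smul_mem' := by
    rintro c u ⟨hu, hu'⟩
    refine ⟨Submodule.smul_mem _ c hu, fun i => ?_⟩
    rw [weakDeriv_smul c hu]
    exact Submodule.smul_mem _ c (hu' i)

/-- The element `(u, ∇u)` of `L²(Ω) × L²(Ω)^ι`; the norm of `H¹(Ω)` is (equivalent to) the norm of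
this pair. -/
def jet (Ω : Opens E) (e : ι → E) (u : L2 Ω) : L2 Ω × (ι → L2 Ω) :=
  (u, fun i => weakDeriv Ω (e i) u)

lemma jet_add {Ω : Opens E} {e : ι → E} {u v : L2 Ω} (hu : u ∈ sobolevH1 Ω e)
    (hv : v ∈ sobolevH1 Ω e) : jet Ω e (u + v) = jet Ω e u + jet Ω e v :=
  Prod.ext rfl (funext fun i => weakDeriv_add hu hv i)

lemma jet_smul {Ω : Opens E} {e : ι → E} {u : L2 Ω} (c : ℂ) (hu : u ∈ sobolevH1 Ω e) :
    jet Ω e (c • u) = c • jet Ω e u :=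
  Prod.ext rfl (funext fun i => weakDeriv_smul c hu i)

lemma jet_zero (Ω : Opens E) (e : ι → E) : jet Ω e 0 = 0 :=
  Prod.ext rfl (funext fun i => weakDeriv_zero Ω (e i))

/-- The pairs `(φ, ∇φ)` with `φ ∈ C_c^∞(Ω)`. -/
def testJets (Ω : Opens E) (e : ι → E) : Submodule ℂ (L2 Ω × (ι → L2 Ω)) where
  carrier := {U | ∃ φ : 𝓓(Ω, ℂ), U.1 =ᵐ[volume.restrict (Ω : Set E)] φ ∧
    ∀ i, U.2 i =ᵐ[volume.restrict (Ω : Set E)] fun x => fderiv ℝ φ x (e i)}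
  add_mem' := by
    rintro U W ⟨φ, h, h'⟩ ⟨ψ, k, k'⟩
    refine ⟨φ + ψ, ?_, fun i => ?_⟩
    · filter_upwards [Lp.coeFn_add U.1 W.1, h, k] with x hx h₁ h₂
      exact hx.trans (congrArg₂ (· + ·) h₁ h₂)
    · filter_upwards [Lp.coeFn_add (U.2 i) (W.2 i), h' i, k' i] with x hx h₁ h₂
      have hφ : DifferentiableAt ℝ φ x := φ.contDiff.differentiable (by simp) x
      have hψ : DifferentiableAt ℝ ψ x := ψ.contDiff.differentiable (by simp) x
      have hs : fderiv ℝ (φ + ψ : 𝓓(Ω, ℂ)) x = fderiv ℝ φ x + fderiv ℝ ψ x :=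
        fderiv_add hφ hψ
      refine hx.trans ((congrArg₂ (· + ·) h₁ h₂).trans ?_)
      rw [hs]
      rfl
  zero_mem' := by
    refine ⟨0, ?_, fun i => ?_⟩
    · filter_upwards [Lp.coeFn_zero ℂ 2 (volume.restrict (Ω : Set E))] with x hx
      exact hx
    · filter_upwards [Lp.coeFn_zero ℂ 2 (volume.restrict (Ω : Set E))] with x hx
      have hs : fderiv ℝ (0 : 𝓓(Ω, ℂ)) x = 0 := fderiv_const_apply (0 : ℂ)
      refine hx.trans ?_
      rw [hs]
      rfl
  smul_mem' := by
    rintro c U ⟨φ, h, h'⟩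
    refine ⟨c • φ, ?_, fun i => ?_⟩
    · filter_upwards [Lp.coeFn_smul c U.1, h] with x hx h₁
      exact hx.trans (congrArg (c • ·) h₁)
    · filter_upwards [Lp.coeFn_smul c (U.2 i), h' i] with x hx h₁
      have hφ : DifferentiableAt ℝ φ x := φ.contDiff.differentiable (by simp) x
      have hs : fderiv ℝ (c • φ : 𝓓(Ω, ℂ)) x = c • fderiv ℝ φ x := fderiv_const_smul hφ c
      refine hx.trans ((congrArg (c • ·) h₁).trans ?_)
      rw [hs]
      rfl

/-- The Sobolev space `H₀¹(Ω)`: the closure of `C_c^∞(Ω)` in `H¹(Ω)`. -/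
def sobolevH10 (Ω : Opens E) (e : ι → E) : Submodule ℂ (L2 Ω) where
  carrier := {u | u ∈ sobolevH1 Ω e ∧ jet Ω e u ∈ (testJets Ω e).topologicalClosure}
  add_mem' := by
    rintro u v ⟨hu, hu'⟩ ⟨hv, hv'⟩
    exact ⟨add_mem hu hv, by rw [jet_add hu hv]; exact add_mem hu' hv'⟩
  zero_mem' := ⟨zero_mem _, by rw [jet_zero]; exact zero_mem _⟩
  smul_mem' := by
    rintro c u ⟨hu, hu'⟩
    exact ⟨Submodule.smul_mem _ c hu, by rw [jet_smul c hu]; exact Submodule.smul_mem _ c hu'⟩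

/-- The weak Laplacian `Δu = ∑ᵢ ∂ᵢ∂ᵢu` of `u ∈ H²(Ω)`. -/
def laplacian [Fintype ι] (Ω : Opens E) (e : ι → E) (u : L2 Ω) : L2 Ω :=
  ∑ i, weakDeriv Ω (e i) (weakDeriv Ω (e i) u)

lemma laplacian_add [Fintype ι] {Ω : Opens E} {e : ι → E} {u v : L2 Ω} (hu : u ∈ sobolevH2 Ω e)
    (hv : v ∈ sobolevH2 Ω e) :
    laplacian Ω e (u + v) = laplacian Ω e u + laplacian Ω e v := by
  simp only [laplacian, ← Finset.sum_add_distrib]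
  refine Finset.sum_congr rfl fun i _ => ?_
  rw [weakDeriv_add hu.1 hv.1, weakDeriv_add (hu.2 i) (hv.2 i)]

lemma laplacian_smul [Fintype ι] {Ω : Opens E} {e : ι → E} {u : L2 Ω} (c : ℂ) (hu : u ∈ sobolevH2 Ω e) :
    laplacian Ω e (c • u) = c • laplacian Ω e u := by
  simp only [laplacian, Finset.smul_sum]
  refine Finset.sum_congr rfl fun i _ => ?_
  rw [weakDeriv_smul c hu.1, weakDeriv_smul c (hu.2 i)]

/-- The Schrödinger operator `u ↦ -Δu + W u` in `L²(Ω)` with bounded potential `W` and with domain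
`H₀¹(Ω) ∩ H²(Ω)`. -/
def dirichletSchrodinger [Fintype ι] (Ω : Opens E) (e : ι → E)
    (W : Lp ℂ ∞ (volume.restrict (Ω : Set E))) : L2 Ω →ₗ.[ℂ] L2 Ω where
  domain := sobolevH10 Ω e ⊓ sobolevH2 Ω e
  toFun :=
    { toFun := fun u => -laplacian Ω e (u : L2 Ω) + (W • (u : L2 Ω) : L2 Ω)
      map_add' := by
        intro u v
        rw [Submodule.coe_add, laplacian_add u.2.2 v.2.2, Lp.add_smul]
        abel
      map_smul' := by
        intro c u
        rw [Submodule.coe_smul, laplacian_smul c u.2.2, ← Lp.smul_comm, RingHom.id_apply, smul_add,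
          smul_neg] }

end Sobolev

/-! ### Norm resolvent convergence -/

section Resolvent

variable {H : Type*} [NormedAddCommGroup H] [InnerProductSpace ℂ H]

/-- The bounded operator `R` is the resolvent `(A - z)⁻¹` of the operator `A`. -/
def IsResolventAt (A : H →ₗ.[ℂ] H) (z : ℂ) (R : H →L[ℂ] H) : Prop :=
  (∀ f : H, ∃ h : R f ∈ A.domain, A ⟨R f, h⟩ - z • R f = f) ∧
    ∀ u : A.domain, R (A u - z • (u : H)) = u

/-- Norm resolvent convergence of self-adjoint operators `A i → B` along the filter `l`:
`(A i - i)⁻¹ → (B - i)⁻¹` in operator norm. -/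
def NormResolventTendsto {κ : Type*} (A : κ → H →ₗ.[ℂ] H) (l : Filter κ) (B : H →ₗ.[ℂ] H) : Prop :=
  ∃ (R : κ → H →L[ℂ] H) (S : H →L[ℂ] H),
    (∀ᶠ k in l, IsResolventAt (A k) Complex.I (R k)) ∧ IsResolventAt B Complex.I S ∧
      Tendsto (fun k => ‖R k - S‖) l (𝓝 0)

end Resolvent

/-! ### The unit disk and the Robin Laplacian -/

/-- The Euclidean plane. -/
abbrev Plane : Type := EuclideanSpace ℝ (Fin 2)

/-- The open unit disk in the plane. -/
def unitDisk : Opens Plane := ⟨ball 0 1, isOpen_ball⟩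

/-- The standard orthonormal frame of the plane. -/
def planeFrame (i : Fin 2) : Plane := EuclideanSpace.single i 1

/-- The boundary of the unit disk. -/
abbrev UnitCircle : Type := sphere (0 : Plane) 1

/-- Arc length measure on the unit circle. -/
def arcLength : Measure UnitCircle := (volume : Measure Plane).toSphere

/-- The triples `(φ, ∇φ, φ|_Σ)` with `φ` smooth on the closed unit disk, `Σ` its boundary circle. -/
def boundaryJets :
    Submodule ℂ ((L2 unitDisk × (Fin 2 → L2 unitDisk)) × Lp ℂ 2 arcLength) where
  carrier := {T | ∃ φ : Plane → ℂ, ContDiff ℝ ∞ φ ∧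
    T.1.1 =ᵐ[volume.restrict (unitDisk : Set Plane)] φ ∧
    (∀ i, T.1.2 i =ᵐ[volume.restrict (unitDisk : Set Plane)]
      fun x => fderiv ℝ φ x (planeFrame i)) ∧
    T.2 =ᵐ[arcLength] fun s => φ s}
  add_mem' := by
    rintro U W ⟨φ, hφ, h, h', h''⟩ ⟨ψ, hψ, k, k', k''⟩
    refine ⟨φ + ψ, hφ.add hψ, ?_, fun i => ?_, ?_⟩
    · filter_upwards [Lp.coeFn_add U.1.1 W.1.1, h, k] with x hx h₁ h₂
      exact hx.trans (congrArg₂ (· + ·) h₁ h₂)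
    · filter_upwards [Lp.coeFn_add (U.1.2 i) (W.1.2 i), h' i, k' i] with x hx h₁ h₂
      have hs : fderiv ℝ (φ + ψ) x = fderiv ℝ φ x + fderiv ℝ ψ x :=
        fderiv_add (hφ.differentiable (by simp) x) (hψ.differentiable (by simp) x)
      refine hx.trans ((congrArg₂ (· + ·) h₁ h₂).trans ?_)
      rw [hs]
      rfl
    · filter_upwards [Lp.coeFn_add U.2 W.2, h'', k''] with x hx h₁ h₂
      exact hx.trans (congrArg₂ (· + ·) h₁ h₂)
  zero_mem' := by
    refine ⟨0, contDiff_const, ?_, fun i => ?_, ?_⟩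
    · filter_upwards [Lp.coeFn_zero ℂ 2 (volume.restrict (unitDisk : Set Plane))] with x hx
      exact hx
    · filter_upwards [Lp.coeFn_zero ℂ 2 (volume.restrict (unitDisk : Set Plane))] with x hx
      refine hx.trans ?_
      have hs : fderiv ℝ (0 : Plane → ℂ) x = 0 := fderiv_const_apply (0 : ℂ)
      rw [hs]
      rfl
    · filter_upwards [Lp.coeFn_zero ℂ 2 arcLength] with x hx
      exact hx
  smul_mem' := by
    rintro c U ⟨φ, hφ, h, h', h''⟩
    refine ⟨c • φ, hφ.const_smul c, ?_, fun i => ?_, ?_⟩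
    · filter_upwards [Lp.coeFn_smul c U.1.1, h] with x hx h₁
      exact hx.trans (congrArg (c • ·) h₁)
    · filter_upwards [Lp.coeFn_smul c (U.1.2 i), h' i] with x hx h₁
      have hs : fderiv ℝ (c • φ) x = c • fderiv ℝ φ x :=
        fderiv_const_smul (hφ.differentiable (by simp) x) c
      refine hx.trans ((congrArg (c • ·) h₁).trans ?_)
      rw [hs]
      rfl
    · filter_upwards [Lp.coeFn_smul c U.2, h''] with x hx h₁
      exact hx.trans (congrArg (c • ·) h₁)

/-- `g ∈ L²(Σ)` is the trace of `u ∈ H¹` on the unit circle `Σ`: the trace map is the continuous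
extension to `H¹` of the restriction map of functions that are smooth on the closed disk. -/
def HasTrace (u : L2 unitDisk) (g : Lp ℂ 2 arcLength) : Prop :=
  u ∈ sobolevH1 unitDisk planeFrame ∧
    (jet unitDisk planeFrame u, g) ∈ boundaryJets.topologicalClosure

lemma HasTrace.add {u v : L2 unitDisk} {g k : Lp ℂ 2 arcLength} (hu : HasTrace u g)
    (hv : HasTrace v k) : HasTrace (u + v) (g + k) :=
  ⟨add_mem hu.1 hv.1, by rw [jet_add hu.1 hv.1]; exact add_mem hu.2 hv.2⟩

lemma HasTrace.smul {u : L2 unitDisk} {g : Lp ℂ 2 arcLength} (c : ℂ) (hu : HasTrace u g) :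
    HasTrace (c • u) (c • g) :=
  ⟨Submodule.smul_mem _ c hu.1, by
    rw [jet_smul c hu.1]; exact Submodule.smul_mem _ c hu.2⟩

lemma HasTrace.zero : HasTrace 0 0 :=
  ⟨zero_mem _, by rw [jet_zero]; exact zero_mem _⟩

/-- The field `x ↦ x / |x|`, which on the unit circle is the outer unit normal of the disk. -/
def outerNormal (x : Plane) : Plane := ‖x‖⁻¹ • x

/-- The shape operator of the unit circle at `s`: the differential of the Gauss map `ν` on the
tangent space `{s}ᗮ`. -/
def shapeOperator (s : UnitCircle) :
    (ℝ ∙ (s : Plane))ᗮ →ₗ[ℝ] (ℝ ∙ (s : Plane))ᗮ :=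
  ((ℝ ∙ (s : Plane))ᗮ.orthogonalProjectionOnto ∘L fderiv ℝ outerNormal s ∘L
    (ℝ ∙ (s : Plane))ᗮ.subtypeL : (ℝ ∙ (s : Plane))ᗮ →L[ℝ] (ℝ ∙ (s : Plane))ᗮ)

/-- The mean curvature of the boundary of the disk: the sum of the `d - 1` principal curvatures
divided by `d - 1`, where `d = 2`. -/
def meanCurvature (s : UnitCircle) : ℝ :=
  LinearMap.trace ℝ _ (shapeOperator s) / (2 - 1)

/-- The unit circle has mean curvature `1`. -/
lemma meanCurvature_eq_one (s : UnitCircle) : meanCurvature s = 1 := by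
  have hs : ‖(s : Plane)‖ = 1 := by simp
  have hs0 : (s : Plane) ≠ 0 := by
    intro h
    simp [h] at hs
  have hd : DifferentiableAt ℝ (fun x : Plane => ‖x‖⁻¹) s :=
    (differentiableAt_id.norm ℝ hs0).inv (by simp [hs])
  have hid : shapeOperator s = LinearMap.id := by
    refine LinearMap.ext fun τ => ?_
    have hf : fderiv ℝ outerNormal s (τ : Plane)
        = (τ : Plane) + fderiv ℝ (fun x : Plane => ‖x‖⁻¹) s (τ : Plane) • (s : Plane) := by
      have h := fderiv_fun_smul hd (differentiableAt_id (𝕜 := ℝ) (x := (s : Plane)))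
      change fderiv ℝ (fun x : Plane => ‖x‖⁻¹ • id x) s (τ : Plane) = _
      rw [h]
      simp [hs]
    change (ℝ ∙ (s : Plane))ᗮ.orthogonalProjectionOnto (fderiv ℝ outerNormal s (τ : Plane)) = τ
    have hz : (ℝ ∙ (s : Plane))ᗮ.orthogonalProjectionOnto (s : Plane) = 0 :=
      Submodule.orthogonalProjectionOnto_orthogonalComplement_singleton_eq_zero _
    rw [hf, map_add, map_smul, hz, smul_zero, add_zero]
    exact Submodule.orthogonalProjectionOnto_mem_subspace_eq_self τ
  have hdim : Module.finrank ℝ (ℝ ∙ (s : Plane))ᗮ = 1 := by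
    have : Fact (Module.finrank ℝ Plane = 1 + 1) := ⟨by simp⟩
    exact Submodule.finrank_orthogonal_span_singleton hs0
  rw [meanCurvature, hid, LinearMap.trace_id, hdim]
  norm_num

/-- The domain of the Robin Laplacian: the `u ∈ H²` with `∂_ν u + ((d - 1) / 2) H u = 0` on the unit
circle, where `d = 2`, `H` is the mean curvature, and `∂_ν u = ∑ᵢ νᵢ ∂ᵢu` is formed with the traces
of the `∂ᵢu`. -/
def robinDomain : Submodule ℂ (L2 unitDisk) where
  carrier := {u | u ∈ sobolevH2 unitDisk planeFrame ∧
    ∃ (g : Lp ℂ 2 arcLength) (p : Fin 2 → Lp ℂ 2 arcLength), HasTrace u g ∧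
      (∀ i, HasTrace (weakDeriv unitDisk (planeFrame i) u) (p i)) ∧
      ∀ᵐ s : UnitCircle ∂arcLength, ∑ i, (outerNormal s i : ℂ) * p i s +
        (((2 - 1) / 2 * meanCurvature s : ℝ) : ℂ) * g s = 0}
  add_mem' := by
    rintro u v ⟨hu, g, p, hg, hp, h⟩ ⟨hv, g', p', hg', hp', h'⟩
    refine ⟨add_mem hu hv, g + g', fun i => p i + p' i, hg.add hg', fun i => ?_, ?_⟩
    · rw [weakDeriv_add hu.1 hv.1]
      exact (hp i).add (hp' i)
    · filter_upwards [h, h', Lp.coeFn_add g g', Lp.coeFn_add (p 0) (p' 0),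
        Lp.coeFn_add (p 1) (p' 1)] with s h h' hs hs₀ hs₁
      simp only [Fin.sum_univ_two, hs, hs₀, hs₁, Pi.add_apply] at h h' ⊢
      linear_combination h + h'
  zero_mem' := by
    refine ⟨zero_mem _, 0, fun _ => 0, .zero, fun i => ?_, ?_⟩
    · rw [weakDeriv_zero]
      exact .zero
    · filter_upwards [Lp.coeFn_zero ℂ 2 arcLength] with s hs
      simp only [hs, Pi.zero_apply, mul_zero, Finset.sum_const_zero, add_zero]
  smul_mem' := by
    rintro c u ⟨hu, g, p, hg, hp, h⟩
    refine ⟨Submodule.smul_mem _ c hu, c • g, fun i => c • p i, hg.smul c, fun i => ?_, ?_⟩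
    · rw [weakDeriv_smul c hu.1]
      exact (hp i).smul c
    · filter_upwards [h, Lp.coeFn_smul c g, Lp.coeFn_smul c (p 0),
        Lp.coeFn_smul c (p 1)] with s h hs hs₀ hs₁
      simp only [Fin.sum_univ_two, hs, hs₀, hs₁, Pi.smul_apply, smul_eq_mul] at h ⊢
      linear_combination c * h

/-- The Robin Laplacian `u ↦ -Δu` in `L²` of the unit disk. -/
def robinLaplacian : L2 unitDisk →ₗ.[ℂ] L2 unitDisk where
  domain := robinDomain
  toFun :=
    { toFun := fun u => -laplacian unitDisk planeFrame (u : L2 unitDisk)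
      map_add' := by
        intro u v
        rw [Submodule.coe_add, laplacian_add u.2.1 v.2.1, neg_add]
      map_smul' := by
        intro c u
        rw [Submodule.coe_smul, laplacian_smul c u.2.1, RingHom.id_apply, smul_neg] }

/-! ### Resonant potentials and the scaled Schrödinger operators -/

/-- A real-valued potential in `C_c^∞([0, ∞))`; only the values at `t ≥ 0` matter. -/
structure HalfLinePotential where
  /-- The underlying function. -/
  toFun : ℝ → ℝ
  smooth : ContDiffOn ℝ ∞ toFun (Ici 0)
  support_bounded : ∃ a > 0, ∀ t > a, toFun t = 0

namespace HalfLinePotential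

instance : CoeFun HalfLinePotential fun _ => ℝ → ℝ := ⟨toFun⟩

/-- `V` is resonant: `-ψ'' + Vψ = 0` on `(0, ∞)`, `ψ(0) = 0` has a bounded non-trivial solution `ψ`
in `C^∞([0, ∞))`. -/
def IsResonant (V : HalfLinePotential) : Prop :=
  ∃ ψ : ℝ → ℝ, ContDiffOn ℝ ∞ ψ (Ici 0) ∧ (∀ t > 0, -deriv (deriv ψ) t + V t * ψ t = 0) ∧
    ψ 0 = 0 ∧ (∃ C : ℝ, ∀ t ≥ 0, |ψ t| ≤ C) ∧ ∃ t ≥ 0, ψ t ≠ 0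

lemma bounded (V : HalfLinePotential) : ∃ C : ℝ, ∀ t ≥ 0, |V t| ≤ C := by
  obtain ⟨a, ha, hV⟩ := V.support_bounded
  obtain ⟨C, hC⟩ := (isCompact_Icc (a := (0 : ℝ)) (b := a)).exists_bound_of_continuousOn
    (V.smooth.continuousOn.mono Icc_subset_Ici_self)
  refine ⟨C, fun t ht => ?_⟩
  rcases le_or_gt t a with h | h
  · exact hC t ⟨ht, h⟩
  · rw [hV t h, abs_zero]
    exact (norm_nonneg _).trans (hC 0 ⟨le_rfl, ha.le⟩)

/-- A function of the form `x ↦ c · V(ρ(x))` with `ρ ≥ 0` continuous on `Ω` is in `L^∞(Ω)`. -/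
lemma memLp_top {E : Type*} [NormedAddCommGroup E] [InnerProductSpace ℝ E]
    [FiniteDimensional ℝ E] [MeasurableSpace E] [BorelSpace E] (V : HalfLinePotential)
    (Ω : Opens E) (c : ℝ) {ρ : E → ℝ} (hρ : ContinuousOn ρ Ω) (h0 : ∀ x ∈ Ω, 0 ≤ ρ x) :
    MemLp (fun x => ((c * V (ρ x) : ℝ) : ℂ)) ∞ (volume.restrict (Ω : Set E)) := by
  obtain ⟨C, hC⟩ := V.bounded
  have hcont : ContinuousOn (fun x => ((c * V (ρ x) : ℝ) : ℂ)) Ω :=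
    Complex.continuous_ofReal.comp_continuousOn
      (continuousOn_const.mul (V.smooth.continuousOn.comp hρ fun x hx => h0 x hx))
  refine memLp_top_of_bound (hcont.aestronglyMeasurable Ω.isOpen.measurableSet) (|c| * C) ?_
  filter_upwards [ae_restrict_mem Ω.isOpen.measurableSet] with x hx
  rw [Complex.norm_real, Real.norm_eq_abs, abs_mul]
  exact mul_le_mul_of_nonneg_left (hC _ (h0 x hx)) (abs_nonneg c)

/-- The open half-line `(0, ∞)`. -/
def halfLine : Opens ℝ := ⟨Ioi 0, isOpen_Ioi⟩

/-- The operator `ψ ↦ -ψ'' + Vψ` in `L²((0, ∞))` with domain `H₀¹((0, ∞)) ∩ H²((0, ∞))`. -/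
def halfLineOperator (V : HalfLinePotential) : L2 halfLine →ₗ.[ℂ] L2 halfLine :=
  dirichletSchrodinger halfLine (fun _ : Unit => (1 : ℝ))
    ((V.memLp_top halfLine 1 continuousOn_id fun _ hx => le_of_lt hx).toLp
      fun t => ((1 * V t : ℝ) : ℂ))

/-- The half-line operator has at least one negative eigenvalue. -/
def HasNegativeEigenvalue (V : HalfLinePotential) : Prop :=
  ∃ μ : ℝ, μ < 0 ∧ ∃ f : V.halfLineOperator.domain,
    f ≠ 0 ∧ V.halfLineOperator f = (μ : ℂ) • (f : L2 halfLine)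

/-- The scaled potential `V_ε(x) = ε⁻² V(dist(x, Σ) / ε)` on the unit disk with boundary `Σ`. -/
def scaledPotential (V : HalfLinePotential) (ε : Ioi (0 : ℝ)) :
    Lp ℂ ∞ (volume.restrict (unitDisk : Set Plane)) :=
  (V.memLp_top unitDisk (1 / (ε : ℝ) ^ 2)
    (ρ := fun x => infDist x (sphere (0 : Plane) 1) / (ε : ℝ))
    ((continuous_infDist_pt _).div_const _).continuousOn
    (fun _ _ => div_nonneg infDist_nonneg (le_of_lt ε.2))).toLp
      fun x => ((1 / (ε : ℝ) ^ 2 * V (infDist x (sphere (0 : Plane) 1) / ε) : ℝ) : ℂ)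

/-- The operator `A_ε = -Δ + V_ε` in `L²` of the unit disk with domain `H₀¹ ∩ H²`. -/
def diskOperator (V : HalfLinePotential) (ε : Ioi (0 : ℝ)) : L2 unitDisk →ₗ.[ℂ] L2 unitDisk :=
  dirichletSchrodinger unitDisk planeFrame (V.scaledPotential ε)

end HalfLinePotential

end

open MeasureTheory Set Filter Topology TopologicalSpace Metric
open scoped ENNReal ContDiff Distributions InnerProductSpace

noncomputable section

set_option linter.unusedSectionVars false

/-! Argue by contradiction on the functions that change sign under the rotation by π/m
(`antiInvariant`); they contain the angular momentum m. Heuristically, a negative eigenvalue μ on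
the half-line gives A_ε an eigenvalue near μ/ε² + m² in this sector. For large m it starts out
positive and tends to -∞ as ε → 0, so it has to cross a neighbourhood of 0, where the Robin
Laplacian has no spectrum in the sector.

The gap: a Poincaré inequality along rotation orbits makes the Robin resolvent small when tested
against the sector, so norm resolvent convergence yields ‖(A_ε - i)⁻¹f‖ ≤ ‖f‖/2 on the sector for
all small ε, once m is large (`norm_resolvent_le`). This smallness excludes spectrum near 0, though
not spectrum far below 0.

No crossing: at a fixed ε₀ the potential is bounded, so for large m the kinetic energy dominates and
A_ε₀ ≥ 1 on the sector (`boundedBelow_of_small_angle`). The potential is continuous in ε in the L^∞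
norm, and the gap forces the lower bound to persist for all ε ≤ ε₀ (`boundedBelow_of_le`, resting on
`norm_sq_le_re_inner_of_nonneg`).

The contradiction: the half-line form is negative at some test function φ (`exists_test_form_neg`).
For fixed m the function z^m φ((1-|z|)/ε) lies in the sector, and its energy is ε⁻¹ times a quantity
converging to a positive multiple of that negative value, so the lower bound fails for small ε
(`HasNegativeEigenvalue.eventually_not_boundedBelow`). -/

/-! ### Test functions as elements of `L²` -/

section TestFunctions

variable {E : Type*} [NormedAddCommGroup E] [InnerProductSpace ℝ E] [FiniteDimensional ℝ E]
  [MeasurableSpace E] [BorelSpace E]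

/-- The directional derivative of a test function. -/
def testDeriv {Ω : Opens E} (a : E) (φ : 𝓓(Ω, ℂ)) : 𝓓(Ω, ℂ) where
  toFun x := fderiv ℝ φ x a
  contDiff' := (φ.contDiff.fderiv_right (m := ∞) (by simp)).clm_apply contDiff_const
  hasCompactSupport' := φ.hasCompactSupport.fderiv_apply ℝ a
  tsupport_subset' := (tsupport_fderiv_apply_subset ℝ a).trans φ.tsupport_subset

/-- The complex conjugate of a test function. -/
def testConj {Ω : Opens E} (φ : 𝓓(Ω, ℂ)) : 𝓓(Ω, ℂ) where
  toFun x := starRingEnd ℂ (φ x)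
  contDiff' := Complex.conjCLE.contDiff.comp φ.contDiff
  hasCompactSupport' := φ.hasCompactSupport.comp_left (g := starRingEnd ℂ) (map_zero _)
  tsupport_subset' := (closure_mono (Function.support_comp_subset (map_zero (starRingEnd ℂ)) φ)).trans
    φ.tsupport_subset

lemma testDeriv_apply {Ω : Opens E} (a : E) (φ : 𝓓(Ω, ℂ)) (x : E) :
    testDeriv a φ x = fderiv ℝ φ x a := rfl

lemma testConj_apply {Ω : Opens E} (φ : 𝓓(Ω, ℂ)) (x : E) :
    testConj φ x = starRingEnd ℂ (φ x) := rfl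

lemma fderiv_testConj {Ω : Opens E} (φ : 𝓓(Ω, ℂ)) (x a : E) :
    fderiv ℝ (testConj φ) x a = starRingEnd ℂ (fderiv ℝ φ x a) := by
  have h : HasFDerivAt φ (fderiv ℝ φ x) x :=
    ((φ.contDiff.differentiable (by simp)) x).hasFDerivAt
  have h2 := (Complex.conjCLE : ℂ →L[ℝ] ℂ).hasFDerivAt.comp x h
  have h3 : HasFDerivAt (testConj φ) ((Complex.conjCLE : ℂ →L[ℝ] ℂ).comp (fderiv ℝ φ x)) x := h2
  rw [h3.fderiv]
  rfl

lemma memLp_test {Ω : Opens E} (φ : 𝓓(Ω, ℂ)) : MemLp φ 2 (volume.restrict (Ω : Set E)) :=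
  φ.continuous.memLp_of_hasCompactSupport φ.hasCompactSupport

/-- A test function as an element of `L²`. -/
def testL2 {Ω : Opens E} (φ : 𝓓(Ω, ℂ)) : L2 Ω := (memLp_test φ).toLp φ

lemma coeFn_testL2 {Ω : Opens E} (φ : 𝓓(Ω, ℂ)) :
    testL2 φ =ᵐ[volume.restrict (Ω : Set E)] φ := (memLp_test φ).coeFn_toLp

lemma inner_testL2 {Ω : Opens E} (φ : 𝓓(Ω, ℂ)) (u : L2 Ω) :
    ⟪testL2 φ, u⟫_ℂ = ∫ x in (Ω : Set E), u x * starRingEnd ℂ (φ x) := by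
  rw [L2.inner_def]
  refine integral_congr_ae ?_
  filter_upwards [coeFn_testL2 φ] with x hx
  rw [hx, RCLike.inner_apply]

/-- Conjugating the test function turns the bilinear pairing into the inner product. In this form
the condition is visibly closed in the pair, and a rotation can be moved across by its adjoint. -/
lemma hasWeakDeriv_iff_inner {Ω : Opens E} {a : E} {u v : L2 Ω} :
    HasWeakDeriv Ω a u v ↔
      ∀ φ : 𝓓(Ω, ℂ), ⟪testL2 (testDeriv a φ), u⟫_ℂ = -⟪testL2 φ, v⟫_ℂ := by
  constructor
  · intro h φ
    have h' := h (testConj φ)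
    simp only [fderiv_testConj, testConj_apply] at h'
    rw [inner_testL2, inner_testL2, ← h']
    rfl
  · intro h φ
    have h' := h (testConj φ)
    rw [inner_testL2, inner_testL2] at h'
    simpa only [testDeriv_apply, fderiv_testConj, testConj_apply, Complex.conj_conj] using h'

lemma isClosed_hasWeakDeriv (Ω : Opens E) (a : E) :
    IsClosed {p : L2 Ω × L2 Ω | HasWeakDeriv Ω a p.1 p.2} := by
  simp only [hasWeakDeriv_iff_inner, Set.ofPred_forall]
  refine isClosed_iInter fun φ => isClosed_eq ?_ ?_
  · exact continuous_const.inner continuous_fst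
  · exact (continuous_const.inner continuous_snd).neg

lemma HasWeakDeriv.direction_smul {Ω : Opens E} {a : E} {u v : L2 Ω} (h : HasWeakDeriv Ω a u v)
    (c : ℝ) : HasWeakDeriv Ω (c • a) u ((c : ℂ) • v) := by
  intro φ
  have h' := (h.smul (c : ℂ)) φ
  have e : ∫ x in (Ω : Set E), ((c : ℂ) • u : L2 Ω) x * fderiv ℝ φ x a
      = ∫ x in (Ω : Set E), u x * fderiv ℝ φ x (c • a) := by
    refine integral_congr_ae ?_
    filter_upwards [Lp.coeFn_smul (c : ℂ) u] with x hx
    rw [hx, Pi.smul_apply, smul_eq_mul, map_smul, Complex.real_smul]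
    ring
  rw [← e, h']

lemma HasWeakDeriv.direction_add {Ω : Opens E} {a b : E} {u v w : L2 Ω}
    (h : HasWeakDeriv Ω a u v) (k : HasWeakDeriv Ω b u w) :
    HasWeakDeriv Ω (a + b) u (v + w) := by
  intro φ
  have e : ∫ x in (Ω : Set E), (v + w : L2 Ω) x * φ x
      = ∫ x in (Ω : Set E), (v x * φ x + w x * φ x) := by
    refine integral_congr_ae ?_
    filter_upwards [Lp.coeFn_add v w] with x hx
    rw [hx, Pi.add_apply, add_mul]
  simp only [map_add, mul_add]
  rw [e, integral_add (integrable_L2_mul_fderiv_test u φ a)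
    (integrable_L2_mul_fderiv_test u φ b), integral_add (integrable_L2_mul_test v φ)
    (integrable_L2_mul_test w φ), h φ, k φ, neg_add]

lemma setIntegral_test_mul {Ω : Opens E} (φ : 𝓓(Ω, ℂ)) (g : E → ℂ) :
    ∫ x in (Ω : Set E), φ x * g x = ∫ x, φ x * g x := by
  refine setIntegral_eq_integral_of_forall_compl_eq_zero fun x hx => ?_
  have : φ x = 0 := by
    by_contra hne
    exact hx (φ.tsupport_subset (subset_tsupport φ hne))
  simp [this]

lemma hasWeakDeriv_testL2 {Ω : Opens E} (a : E) (φ : 𝓓(Ω, ℂ)) :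
    HasWeakDeriv Ω a (testL2 φ) (testL2 (testDeriv a φ)) := by
  intro ψ
  have e₁ : ∫ x in (Ω : Set E), testL2 φ x * fderiv ℝ ψ x a
      = ∫ x in (Ω : Set E), φ x * testDeriv a ψ x := by
    refine integral_congr_ae ?_
    filter_upwards [coeFn_testL2 φ] with x hx
    rw [hx]; rfl
  have e₂ : ∫ x in (Ω : Set E), testL2 (testDeriv a φ) x * ψ x
      = ∫ x in (Ω : Set E), testDeriv a φ x * ψ x := by
    refine integral_congr_ae ?_
    filter_upwards [coeFn_testL2 (testDeriv a φ)] with x hx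
    rw [hx]
  have hint (α β : 𝓓(Ω, ℂ)) : Integrable (fun x => α x * β x) :=
    (α.continuous.mul β.continuous).integrable_of_hasCompactSupport
      α.hasCompactSupport.mul_right
  rw [e₁, e₂, setIntegral_test_mul, setIntegral_test_mul]
  exact integral_mul_fderiv_eq_neg_fderiv_mul_of_integrable (hint (testDeriv a φ) ψ)
    (hint φ (testDeriv a ψ)) (hint φ ψ) (fun x _ => φ.contDiff.differentiable (by simp) x)
    (fun x _ => ψ.contDiff.differentiable (by simp) x)

variable {ι : Type*}

lemma testL2_mem_sobolevH1 {Ω : Opens E} (e : ι → E) (φ : 𝓓(Ω, ℂ)) :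
    testL2 φ ∈ sobolevH1 Ω e := fun i => ⟨_, hasWeakDeriv_testL2 (e i) φ⟩

lemma weakDeriv_testL2 {Ω : Opens E} (a : E) (φ : 𝓓(Ω, ℂ)) :
    weakDeriv Ω a (testL2 φ) = testL2 (testDeriv a φ) :=
  weakDeriv_eq (hasWeakDeriv_testL2 a φ)

lemma testL2_mem_sobolevH2 {Ω : Opens E} (e : ι → E) (φ : 𝓓(Ω, ℂ)) :
    testL2 φ ∈ sobolevH2 Ω e :=
  ⟨testL2_mem_sobolevH1 e φ, fun i => by
    rw [weakDeriv_testL2]; exact testL2_mem_sobolevH1 e _⟩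

lemma jet_testL2_mem {Ω : Opens E} (e : ι → E) (φ : 𝓓(Ω, ℂ)) :
    jet Ω e (testL2 φ) ∈ testJets Ω e :=
  ⟨φ, coeFn_testL2 φ, fun i => by
    change weakDeriv Ω (e i) (testL2 φ) =ᵐ[_] _
    rw [weakDeriv_testL2]; exact coeFn_testL2 (testDeriv (e i) φ)⟩

lemma testL2_mem_sobolevH10 {Ω : Opens E} (e : ι → E) (φ : 𝓓(Ω, ℂ)) :
    testL2 φ ∈ sobolevH10 Ω e :=
  ⟨testL2_mem_sobolevH1 e φ, subset_closure (jet_testL2_mem e φ)⟩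

lemma eq_testL2_of_mem_testJets {Ω : Opens E} {e : ι → E} {U : L2 Ω × (ι → L2 Ω)}
    (h : U ∈ testJets Ω e) :
    ∃ φ : 𝓓(Ω, ℂ), U = (testL2 φ, fun i => testL2 (testDeriv (e i) φ)) := by
  obtain ⟨φ, h₁, h₂⟩ := h
  exact ⟨φ, Prod.ext (Lp.ext (h₁.trans (coeFn_testL2 φ).symm)) (funext fun i =>
    Lp.ext ((h₂ i).trans (coeFn_testL2 (testDeriv (e i) φ)).symm))⟩

lemma hasWeakDeriv_weakDeriv {Ω : Opens E} {e : ι → E} {u : L2 Ω} (hu : u ∈ sobolevH1 Ω e)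
    (i : ι) : HasWeakDeriv Ω (e i) u (weakDeriv Ω (e i) u) := by
  obtain ⟨v, hv⟩ := hu i
  rwa [weakDeriv_eq hv]

/-- Green's formula: integration by parts against an element of `H₀¹`. -/
lemma inner_laplacian [Fintype ι] {Ω : Opens E} {e : ι → E} {u v : L2 Ω}
    (hu : u ∈ sobolevH2 Ω e) (hv : v ∈ sobolevH10 Ω e) :
    ⟪v, laplacian Ω e u⟫_ℂ = -∑ i, ⟪weakDeriv Ω (e i) v, weakDeriv Ω (e i) u⟫_ℂ := by
  -- On test jets this is the definition of the weak derivatives of the ∂ᵢu; both sides are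
  -- continuous in the jet, so the identity extends to the closure.
  have key : ∀ U ∈ (testJets Ω e).topologicalClosure,
      ⟪U.1, laplacian Ω e u⟫_ℂ = -∑ i, ⟪U.2 i, weakDeriv Ω (e i) u⟫_ℂ := by
    intro U hU
    refine closure_minimal (s := (testJets Ω e : Set (L2 Ω × (ι → L2 Ω))))
      (t := {U : L2 Ω × (ι → L2 Ω) | ⟪U.1, laplacian Ω e u⟫_ℂ = -∑ i, ⟪U.2 i, weakDeriv Ω (e i) u⟫_ℂ}) ?_ ?_ hU
    · intro U hU
      obtain ⟨φ, rfl⟩ := eq_testL2_of_mem_testJets hU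
      simp only [mem_ofPred_eq, laplacian, inner_sum, ← Finset.sum_neg_distrib]
      refine Finset.sum_congr rfl fun i _ => ?_
      rw [hasWeakDeriv_iff_inner.1 (hasWeakDeriv_weakDeriv (hu.2 i) i) φ, neg_neg]
    · refine isClosed_eq (continuous_fst.inner continuous_const) ?_
      refine (continuous_finsetSum _ fun i _ => ?_).neg
      exact ((continuous_apply i).comp continuous_snd).inner continuous_const
  exact key _ hv.2

variable [Fintype ι] {Ω : Opens E} {e : ι → E} {W : Lp ℂ ∞ (volume.restrict (Ω : Set E))}

lemma dirichletSchrodinger_apply (u : (dirichletSchrodinger Ω e W).domain) :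
    dirichletSchrodinger Ω e W u = -laplacian Ω e (u : L2 Ω) + (W • (u : L2 Ω) : L2 Ω) := rfl

lemma inner_dirichletSchrodinger (u v : (dirichletSchrodinger Ω e W).domain) :
    ⟪(v : L2 Ω), dirichletSchrodinger Ω e W u⟫_ℂ
      = ∑ i, ⟪weakDeriv Ω (e i) v, weakDeriv Ω (e i) u⟫_ℂ + ⟪(v : L2 Ω), (W • (u : L2 Ω) : L2 Ω)⟫_ℂ := by
  rw [dirichletSchrodinger_apply, inner_add_right, inner_neg_right,
    inner_laplacian u.2.2 v.2.1, neg_neg]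

lemma inner_lpSMul_comm (hW : ∀ᵐ x ∂(volume.restrict (Ω : Set E)), starRingEnd ℂ (W x) = W x)
    (u v : L2 Ω) : ⟪(W • u : L2 Ω), v⟫_ℂ = ⟪u, (W • v : L2 Ω)⟫_ℂ := by
  rw [L2.inner_def, L2.inner_def]
  refine integral_congr_ae ?_
  filter_upwards [hW, Lp.coeFn_lpSMul (r := 2) W u, Lp.coeFn_lpSMul (r := 2) W v] with x h h₁ h₂
  rw [h₁, h₂]
  simp only [Pi.smul_apply', smul_eq_mul, RCLike.inner_apply, map_mul, h]
  ring

/-- Schrödinger operators with real potential are symmetric. -/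
lemma dirichletSchrodinger_symm
    (hW : ∀ᵐ x ∂(volume.restrict (Ω : Set E)), starRingEnd ℂ (W x) = W x)
    (u v : (dirichletSchrodinger Ω e W).domain) :
    ⟪dirichletSchrodinger Ω e W u, (v : L2 Ω)⟫_ℂ = ⟪(u : L2 Ω), dirichletSchrodinger Ω e W v⟫_ℂ := by
  rw [← inner_conj_symm, inner_dirichletSchrodinger, inner_dirichletSchrodinger, map_add, map_sum]
  simp only [inner_conj_symm]
  rw [inner_lpSMul_comm hW]

end TestFunctions

/-! ### Rotations of the disk -/

section Rotation

/-- The identification of the plane with `ℂ`. -/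
def planeComplex : Plane ≃ₗᵢ[ℝ] ℂ := Complex.orthonormalBasisOneI.repr.symm

/-- The rotation of the plane by the angle `s`. -/
def planeRot (s : ℝ) : Plane ≃ₗᵢ[ℝ] Plane :=
  (planeComplex.trans (rotation (Circle.exp s))).trans planeComplex.symm

lemma planeComplex_frame_zero : planeComplex (planeFrame 0) = 1 := by
  simp [planeComplex, planeFrame]

lemma planeComplex_frame_one : planeComplex (planeFrame 1) = Complex.I := by
  simp [planeComplex, planeFrame]

lemma planeComplex_apply (x : Plane) : planeComplex x = x 0 + x 1 * Complex.I := by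
  have hx : x = x 0 • planeFrame 0 + x 1 • planeFrame 1 := by
    ext i
    fin_cases i <;> simp [planeFrame]
  conv_lhs => rw [hx]
  rw [map_add, map_smul, map_smul, planeComplex_frame_zero, planeComplex_frame_one]
  simp

lemma planeComplex_rot (s : ℝ) (x : Plane) :
    planeComplex (planeRot s x) = Complex.exp (s * Complex.I) * planeComplex x := by
  simp [planeRot, rotation_apply]

lemma planeRot_frame_zero (s : ℝ) :
    planeRot s (planeFrame 0) = Real.cos s • planeFrame 0 + Real.sin s • planeFrame 1 := by
  apply planeComplex.injective
  rw [planeComplex_rot, map_add, map_smul, map_smul, planeComplex_frame_zero,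
    planeComplex_frame_one, Complex.exp_mul_I]
  simp

lemma planeRot_frame_one (s : ℝ) :
    planeRot s (planeFrame 1) = (-Real.sin s) • planeFrame 0 + Real.cos s • planeFrame 1 := by
  apply planeComplex.injective
  rw [planeComplex_rot, map_add, map_smul, map_smul, planeComplex_frame_zero,
    planeComplex_frame_one, Complex.exp_mul_I]
  simp only [Complex.real_smul, Complex.ofReal_cos, Complex.ofReal_neg, Complex.ofReal_sin]
  linear_combination Complex.sin s * Complex.I_sq

lemma planeRot_neg_apply (s : ℝ) (x : Plane) : planeRot (-s) (planeRot s x) = x := by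
  apply planeComplex.injective
  rw [planeComplex_rot, planeComplex_rot, ← mul_assoc, ← Complex.exp_add]
  simp

lemma measurePreserving_planeRot (s : ℝ) :
    MeasurePreserving (planeRot s) (volume.restrict (unitDisk : Set Plane))
      (volume.restrict (unitDisk : Set Plane)) := by
  have h := (planeRot s).measurePreserving.restrict_preimage unitDisk.isOpen.measurableSet
  have e : planeRot s ⁻¹' (unitDisk : Set Plane) = unitDisk := by
    ext x
    simp [unitDisk]
  rwa [e] at h

/-- Composition with the rotation by the angle `s`, as an isometry of `L²`. -/
def diskRot (s : ℝ) : L2 unitDisk →ₗᵢ[ℂ] L2 unitDisk :=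
  Lp.compMeasurePreservingₗᵢ ℂ (planeRot s) (measurePreserving_planeRot s)

lemma coeFn_diskRot (s : ℝ) (u : L2 unitDisk) :
    diskRot s u =ᵐ[volume.restrict (unitDisk : Set Plane)] fun x => u (planeRot s x) :=
  Lp.coeFn_compMeasurePreserving u (measurePreserving_planeRot s)

lemma diskRot_apply_neg (s : ℝ) (u : L2 unitDisk) : diskRot s (diskRot (-s) u) = u := by
  refine Lp.ext ?_
  filter_upwards [coeFn_diskRot s (diskRot (-s) u),
    (measurePreserving_planeRot s).quasiMeasurePreserving.ae (coeFn_diskRot (-s) u)] with x h₁ h₂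
  rw [h₁, h₂, planeRot_neg_apply]

lemma inner_diskRot (s : ℝ) (u v : L2 unitDisk) :
    ⟪diskRot s u, v⟫_ℂ = ⟪u, diskRot (-s) v⟫_ℂ := by
  conv_lhs => rw [← diskRot_apply_neg s v]
  exact (diskRot s).inner_map_map _ _

/-- The composition of a test function with a rotation. -/
def testRot (s : ℝ) (φ : 𝓓(unitDisk, ℂ)) : 𝓓(unitDisk, ℂ) where
  toFun x := φ (planeRot s x)
  contDiff' := φ.contDiff.comp (planeRot s).contDiff
  hasCompactSupport' := φ.hasCompactSupport.comp_homeomorph (planeRot s).toHomeomorph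
  tsupport_subset' := by
    intro x hx
    have h := tsupport_comp_subset_preimage φ (planeRot s).continuous hx
    have h2 := φ.tsupport_subset h
    simpa [unitDisk] using h2

lemma testRot_apply (s : ℝ) (φ : 𝓓(unitDisk, ℂ)) (x : Plane) :
    testRot s φ x = φ (planeRot s x) := rfl

lemma testDeriv_testRot (s : ℝ) (a : Plane) (φ : 𝓓(unitDisk, ℂ)) :
    testDeriv a (testRot s φ) = testRot s (testDeriv (planeRot s a) φ) := by
  ext x
  have h : HasFDerivAt φ (fderiv ℝ φ (planeRot s x)) (planeRot s x) :=
    ((φ.contDiff.differentiable (by simp)) _).hasFDerivAt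
  have h2 : HasFDerivAt (testRot s φ) _ x :=
    h.comp x ((planeRot s).toContinuousLinearEquiv : Plane →L[ℝ] Plane).hasFDerivAt
  rw [testDeriv_apply, h2.fderiv]
  rfl

lemma diskRot_testL2 (s : ℝ) (φ : 𝓓(unitDisk, ℂ)) : diskRot s (testL2 φ) = testL2 (testRot s φ) := by
  refine Lp.ext ?_
  filter_upwards [coeFn_diskRot s (testL2 φ), coeFn_testL2 (testRot s φ),
    (measurePreserving_planeRot s).quasiMeasurePreserving.ae (coeFn_testL2 φ)] with x h₁ h₂ h₃
  rw [h₁, h₂, h₃, testRot_apply]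

/-- By duality the rotation falls on the test function, where the classical chain rule applies. -/
lemma HasWeakDeriv.diskRot {s : ℝ} {a : Plane} {u v : L2 unitDisk}
    (h : HasWeakDeriv unitDisk (planeRot s a) u v) :
    HasWeakDeriv unitDisk a (diskRot s u) (diskRot s v) := by
  rw [hasWeakDeriv_iff_inner] at h ⊢
  intro φ
  have h' := h (testRot (-s) φ)
  rw [testDeriv_testRot, planeRot_neg_apply, ← diskRot_testL2, ← diskRot_testL2,
    inner_diskRot, inner_diskRot, neg_neg] at h'
  exact h'

lemma hasWeakDeriv_diskRot_zero (s : ℝ) {u : L2 unitDisk} (hu : u ∈ sobolevH1 unitDisk planeFrame) :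
    HasWeakDeriv unitDisk (planeFrame 0) (diskRot s u)
      (diskRot s (((Real.cos s : ℝ) : ℂ) • weakDeriv unitDisk (planeFrame 0) u +
        ((Real.sin s : ℝ) : ℂ) • weakDeriv unitDisk (planeFrame 1) u)) := by
  apply HasWeakDeriv.diskRot
  rw [planeRot_frame_zero]
  exact ((hasWeakDeriv_weakDeriv hu 0).direction_smul _).direction_add
    ((hasWeakDeriv_weakDeriv hu 1).direction_smul _)

lemma hasWeakDeriv_diskRot_one (s : ℝ) {u : L2 unitDisk} (hu : u ∈ sobolevH1 unitDisk planeFrame) :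
    HasWeakDeriv unitDisk (planeFrame 1) (diskRot s u)
      (diskRot s (((-Real.sin s : ℝ) : ℂ) • weakDeriv unitDisk (planeFrame 0) u +
        ((Real.cos s : ℝ) : ℂ) • weakDeriv unitDisk (planeFrame 1) u)) := by
  apply HasWeakDeriv.diskRot
  rw [planeRot_frame_one]
  exact ((hasWeakDeriv_weakDeriv hu 0).direction_smul _).direction_add
    ((hasWeakDeriv_weakDeriv hu 1).direction_smul _)

lemma diskRot_mem_sobolevH1 (s : ℝ) {u : L2 unitDisk} (hu : u ∈ sobolevH1 unitDisk planeFrame) :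
    diskRot s u ∈ sobolevH1 unitDisk planeFrame := by
  intro i
  fin_cases i
  · exact ⟨_, hasWeakDeriv_diskRot_zero s hu⟩
  · exact ⟨_, hasWeakDeriv_diskRot_one s hu⟩

lemma diskRot_mem_sobolevH2 (s : ℝ) {u : L2 unitDisk} (hu : u ∈ sobolevH2 unitDisk planeFrame) :
    diskRot s u ∈ sobolevH2 unitDisk planeFrame := by
  refine ⟨diskRot_mem_sobolevH1 s hu.1, fun i => ?_⟩
  fin_cases i
  · simp only [Fin.zero_eta, weakDeriv_eq (hasWeakDeriv_diskRot_zero s hu.1)]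
    exact diskRot_mem_sobolevH1 s (add_mem (Submodule.smul_mem _ _ (hu.2 0))
      (Submodule.smul_mem _ _ (hu.2 1)))
  · simp only [Fin.mk_one, weakDeriv_eq (hasWeakDeriv_diskRot_one s hu.1)]
    exact diskRot_mem_sobolevH1 s (add_mem (Submodule.smul_mem _ _ (hu.2 0))
      (Submodule.smul_mem _ _ (hu.2 1)))

/-- The coefficients of ∂₀∂₁u and of ∂₁∂₀u vanish separately, so symmetry of mixed weak derivatives
plays no role; the pure second derivatives get the factor cos² + sin² = 1. -/
lemma laplacian_diskRot (s : ℝ) {u : L2 unitDisk} (hu : u ∈ sobolevH2 unitDisk planeFrame) :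
    laplacian unitDisk planeFrame (diskRot s u) = diskRot s (laplacian unitDisk planeFrame u) := by
  have m (c : ℂ) (i : Fin 2) := Submodule.smul_mem _ c (hu.2 i)
  have e (c d : ℂ) (i : Fin 2) : weakDeriv unitDisk (planeFrame i)
      (c • weakDeriv unitDisk (planeFrame 0) u + d • weakDeriv unitDisk (planeFrame 1) u)
      = c • weakDeriv unitDisk (planeFrame i) (weakDeriv unitDisk (planeFrame 0) u)
        + d • weakDeriv unitDisk (planeFrame i) (weakDeriv unitDisk (planeFrame 1) u) := by
    rw [weakDeriv_add (m c 0) (m d 1), weakDeriv_smul c (hu.2 0), weakDeriv_smul d (hu.2 1)]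
  have h : ((Real.cos s : ℝ) : ℂ) ^ 2 + ((Real.sin s : ℝ) : ℂ) ^ 2 = 1 := by
    norm_cast
    exact Real.cos_sq_add_sin_sq s
  rw [laplacian, laplacian, Fin.sum_univ_two, Fin.sum_univ_two,
    weakDeriv_eq (hasWeakDeriv_diskRot_zero s hu.1), weakDeriv_eq (hasWeakDeriv_diskRot_one s hu.1),
    weakDeriv_eq (hasWeakDeriv_diskRot_zero s (add_mem (m _ 0) (m _ 1))),
    weakDeriv_eq (hasWeakDeriv_diskRot_one s (add_mem (m _ 0) (m _ 1))), ← map_add]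
  simp only [e]
  congr 1
  rw [Complex.ofReal_neg]
  generalize ((Real.cos s : ℝ) : ℂ) = c at h ⊢
  generalize ((Real.sin s : ℝ) : ℂ) = d at h ⊢
  match_scalars
  · linear_combination h
  · ring
  · ring
  · linear_combination h

/-- The action of a rotation on pairs `(u, ∇u)`. -/
def jetRot (s : ℝ) (U : L2 unitDisk × (Fin 2 → L2 unitDisk)) :
    L2 unitDisk × (Fin 2 → L2 unitDisk) :=
  (diskRot s U.1,
    ![diskRot s (((Real.cos s : ℝ) : ℂ) • U.2 0 + ((Real.sin s : ℝ) : ℂ) • U.2 1),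
      diskRot s (((-Real.sin s : ℝ) : ℂ) • U.2 0 + ((Real.cos s : ℝ) : ℂ) • U.2 1)])

lemma continuous_jetRot (s : ℝ) : Continuous (jetRot s) := by
  have h (i : Fin 2) : Continuous fun U : L2 unitDisk × (Fin 2 → L2 unitDisk) => U.2 i :=
    (continuous_apply i).comp continuous_snd
  refine ((diskRot s).continuous.comp continuous_fst).prodMk (continuous_pi fun i => ?_)
  fin_cases i
  · exact (diskRot s).continuous.comp (((h 0).fun_const_smul _).fun_add ((h 1).fun_const_smul _))
  · exact (diskRot s).continuous.comp (((h 0).fun_const_smul _).fun_add ((h 1).fun_const_smul _))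

lemma jet_diskRot (s : ℝ) {u : L2 unitDisk} (hu : u ∈ sobolevH1 unitDisk planeFrame) :
    jet unitDisk planeFrame (diskRot s u) = jetRot s (jet unitDisk planeFrame u) := by
  refine Prod.ext rfl (funext fun i => ?_)
  fin_cases i
  · exact weakDeriv_eq (hasWeakDeriv_diskRot_zero s hu)
  · exact weakDeriv_eq (hasWeakDeriv_diskRot_one s hu)

lemma diskRot_mem_sobolevH10 (s : ℝ) {u : L2 unitDisk} (hu : u ∈ sobolevH10 unitDisk planeFrame) :
    diskRot s u ∈ sobolevH10 unitDisk planeFrame := by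
  refine ⟨diskRot_mem_sobolevH1 s hu.1, ?_⟩
  rw [jet_diskRot s hu.1]
  -- `jetRot` is defined and continuous on all pairs, and it maps test jets to test jets.
  refine map_mem_closure (continuous_jetRot s) hu.2 fun U hU => ?_
  obtain ⟨φ, rfl⟩ := eq_testL2_of_mem_testJets hU
  have h := jet_diskRot s (testL2_mem_sobolevH1 planeFrame φ)
  have h2 : jet unitDisk planeFrame (testL2 φ)
      = (testL2 φ, fun i => testL2 (testDeriv (planeFrame i) φ)) :=
    Prod.ext rfl (funext fun i => weakDeriv_testL2 _ φ)
  rw [← h2, ← h, diskRot_testL2]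
  exact jet_testL2_mem planeFrame _

lemma diskRot_lpSMul (s : ℝ) {W : Lp ℂ ∞ (volume.restrict (unitDisk : Set Plane))}
    (hW : ∀ᵐ x ∂(volume.restrict (unitDisk : Set Plane)), W (planeRot s x) = W x)
    (u : L2 unitDisk) : diskRot s (W • u : L2 unitDisk) = (W • diskRot s u : L2 unitDisk) := by
  refine Lp.ext ?_
  filter_upwards [hW, coeFn_diskRot s (W • u : L2 unitDisk), coeFn_diskRot s u,
    Lp.coeFn_lpSMul (r := 2) W (diskRot s u),
    (measurePreserving_planeRot s).quasiMeasurePreserving.ae (Lp.coeFn_lpSMul (r := 2) W u)]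
    with x h₁ h₂ h₃ h₄ h₅
  rw [h₂, h₅, h₄, Pi.smul_apply', Pi.smul_apply', h₁, h₃]

lemma diskRot_mem_domain (s : ℝ) {W : Lp ℂ ∞ (volume.restrict (unitDisk : Set Plane))}
    {u : L2 unitDisk} (hu : u ∈ (dirichletSchrodinger unitDisk planeFrame W).domain) :
    diskRot s u ∈ (dirichletSchrodinger unitDisk planeFrame W).domain :=
  ⟨diskRot_mem_sobolevH10 s hu.1, diskRot_mem_sobolevH2 s hu.2⟩

/-- Schrödinger operators on the disk with rotation invariant potential commute with rotations. -/
lemma dirichletSchrodinger_diskRot (s : ℝ) {W : Lp ℂ ∞ (volume.restrict (unitDisk : Set Plane))}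
    (hW : ∀ᵐ x ∂(volume.restrict (unitDisk : Set Plane)), W (planeRot s x) = W x)
    (u : (dirichletSchrodinger unitDisk planeFrame W).domain) :
    dirichletSchrodinger unitDisk planeFrame W ⟨diskRot s u, diskRot_mem_domain s u.2⟩
      = diskRot s (dirichletSchrodinger unitDisk planeFrame W u) := by
  rw [dirichletSchrodinger_apply, dirichletSchrodinger_apply, map_add, map_neg,
    laplacian_diskRot s u.2.2, diskRot_lpSMul s hW]

/-- The resolvent of an operator that commutes with a rotation commutes with this rotation. -/
lemma IsResolventAt.diskRot_comm {s : ℝ} {W : Lp ℂ ∞ (volume.restrict (unitDisk : Set Plane))}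
    (hW : ∀ᵐ x ∂(volume.restrict (unitDisk : Set Plane)), W (planeRot s x) = W x)
    {z : ℂ} {R : L2 unitDisk →L[ℂ] L2 unitDisk}
    (hR : IsResolventAt (dirichletSchrodinger unitDisk planeFrame W) z R) (f : L2 unitDisk) :
    R (diskRot s f) = diskRot s (R f) := by
  obtain ⟨h, hf⟩ := hR.1 f
  have h2 := hR.2 ⟨diskRot s (R f), diskRot_mem_domain s h⟩
  rwa [dirichletSchrodinger_diskRot s hW ⟨R f, h⟩, ← map_smul, ← map_sub, hf] at h2

end Rotation

/-! ### A Poincaré inequality for rotations -/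

section Poincare

lemma L2_norm_sq_eq {E : Type*} [NormedAddCommGroup E] [InnerProductSpace ℝ E]
    [FiniteDimensional ℝ E] [MeasurableSpace E] [BorelSpace E] {Ω : Opens E} (f : L2 Ω) :
    ‖f‖ ^ 2 = ∫ x in (Ω : Set E), ‖f x‖ ^ 2 := by
  have h : ((‖f‖ ^ 2 : ℝ) : ℂ) = ((∫ x in (Ω : Set E), ‖f x‖ ^ 2 : ℝ) : ℂ) := by
    rw [Complex.ofReal_pow]
    refine (inner_self_eq_norm_sq_to_K (𝕜 := ℂ) f).symm.trans ?_
    rw [L2.inner_def, ← integral_complex_ofReal]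
    refine integral_congr_ae (Eventually.of_forall fun x => ?_)
    refine (inner_self_eq_norm_sq_to_K (𝕜 := ℂ) (f x)).trans ?_
    simp
  exact_mod_cast h

lemma continuous_planeRot_comp {X : Type*} [TopologicalSpace X] {f : X → ℝ} {g : X → Plane}
    (hf : Continuous f) (hg : Continuous g) : Continuous fun p => planeRot (f p) (g p) := by
  have h : (fun p => planeRot (f p) (g p))
      = fun p => planeComplex.symm (Complex.exp (f p * Complex.I) * planeComplex (g p)) := by
    funext p
    rw [← planeComplex_rot, LinearIsometryEquiv.symm_apply_apply]
  rw [h]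
  refine planeComplex.symm.continuous.comp (Continuous.mul ?_ ?_)
  · fun_prop
  · exact planeComplex.continuous.comp hg

lemma exists_hasDerivAt_planeRot (s : ℝ) (x : Plane) :
    ∃ v : Plane, ‖v‖ = ‖x‖ ∧ HasDerivAt (fun t => planeRot t x) v s := by
  refine ⟨planeComplex.symm (Complex.exp (s * Complex.I) * Complex.I * planeComplex x), ?_, ?_⟩
  · simp [Complex.norm_exp_ofReal_mul_I]
  · have h : (fun t => planeRot t x)
        = fun t : ℝ => planeComplex.symm (Complex.exp (t * Complex.I) * planeComplex x) := by
      funext t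
      rw [← planeComplex_rot, LinearIsometryEquiv.symm_apply_apply]
    rw [h]
    have h1 : HasDerivAt (fun t : ℝ => Complex.exp (t * Complex.I) * planeComplex x)
        (Complex.exp (s * Complex.I) * Complex.I * planeComplex x) s := by
      have := (((hasDerivAt_id (s : ℂ)).mul_const Complex.I).cexp.mul_const
        (planeComplex x)).comp_ofReal
      simpa using this
    exact ((planeComplex.symm.toContinuousLinearEquiv : ℂ →L[ℝ] Plane).hasFDerivAt).comp_hasDerivAt
      s h1

lemma norm_map_sq_le (L : Plane →L[ℝ] ℂ) (v : Plane) :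
    ‖L v‖ ^ 2 ≤ ‖v‖ ^ 2 * ∑ i, ‖L (planeFrame i)‖ ^ 2 := by
  have hv : v = v 0 • planeFrame 0 + v 1 • planeFrame 1 := by
    ext i
    fin_cases i <;> simp [planeFrame]
  have h1 : ‖L v‖ ≤ |v 0| * ‖L (planeFrame 0)‖ + |v 1| * ‖L (planeFrame 1)‖ := by
    conv_lhs => rw [hv]
    rw [map_add, map_smul, map_smul]
    refine (norm_add_le _ _).trans (le_of_eq ?_)
    rw [norm_smul, norm_smul, Real.norm_eq_abs, Real.norm_eq_abs]
  rw [EuclideanSpace.norm_sq_eq, Fin.sum_univ_two, Fin.sum_univ_two, Real.norm_eq_abs,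
    Real.norm_eq_abs]
  refine (pow_le_pow_left₀ (norm_nonneg _) h1 2).trans ?_
  nlinarith [sq_nonneg (|v 0| * ‖L (planeFrame 1)‖ - |v 1| * ‖L (planeFrame 0)‖)]

/-- Cauchy–Schwarz, read off from the nonnegativity of the variance: integrate the square of h minus
its mean I / a. -/
lemma sq_intervalIntegral_le {a : ℝ} (ha : 0 ≤ a) {h : ℝ → ℝ} (hh : Continuous h) :
    (∫ s in (0 : ℝ)..a, h s) ^ 2 ≤ a * ∫ s in (0 : ℝ)..a, h s ^ 2 := by
  rcases ha.eq_or_lt with rfl | ha'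
  · simp
  set I := ∫ s in (0 : ℝ)..a, h s with hI
  have h0 : 0 ≤ ∫ s in (0 : ℝ)..a, (h s - I / a) ^ 2 :=
    intervalIntegral.integral_nonneg ha fun s _ => sq_nonneg _
  have h1 : ∫ s in (0 : ℝ)..a, (h s - I / a) ^ 2
      = (∫ s in (0 : ℝ)..a, h s ^ 2) - 2 * (I / a) * I + a * (I / a) ^ 2 := by
    have e : ∀ s, (h s - I / a) ^ 2 = h s ^ 2 - 2 * (I / a) * h s + (I / a) ^ 2 := fun s => by ring
    simp only [e]
    rw [intervalIntegral.integral_add, intervalIntegral.integral_sub,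
      intervalIntegral.integral_const_mul, ← hI, intervalIntegral.integral_const]
    · simp
    all_goals exact Continuous.intervalIntegrable (by fun_prop) _ _
  rw [h1] at h0
  have h2 : a * ((∫ s in (0 : ℝ)..a, h s ^ 2) - 2 * (I / a) * I + a * (I / a) ^ 2)
      = a * (∫ s in (0 : ℝ)..a, h s ^ 2) - I ^ 2 := by
    field_simp
    ring
  have h3 := mul_nonneg ha h0
  rw [h2] at h3
  linarith

lemma continuous_sum_norm_fderiv_sq {φ : Plane → ℂ} (hφ : ContDiff ℝ ∞ φ) :
    Continuous fun x => ∑ i, ‖fderiv ℝ φ x (planeFrame i)‖ ^ 2 := by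
  have hD : Continuous (fderiv ℝ φ) := hφ.continuous_fderiv (by simp)
  fun_prop

/-- Along the orbit of x the function changes by the integral of its derivative in the direction of
motion, and the speed is ‖x‖ ≤ 1. Cauchy–Schwarz in the angle gives one factor a; Fubini and the
rotation invariance of the disk give the other. -/
lemma integral_rot_sub_sq_le {φ : Plane → ℂ} (hφ : ContDiff ℝ ∞ φ) {a : ℝ} (ha : 0 ≤ a) :
    ∫ x in (unitDisk : Set Plane), ‖φ (planeRot a x) - φ x‖ ^ 2
      ≤ a ^ 2 * ∫ x in (unitDisk : Set Plane), ∑ i, ‖fderiv ℝ φ x (planeFrame i)‖ ^ 2 := by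
  set G : Plane → ℝ := fun x => ∑ i, ‖fderiv ℝ φ x (planeFrame i)‖ ^ 2 with hG
  have hGc : Continuous G := continuous_sum_norm_fderiv_sq hφ
  have hrot (x : Plane) : Continuous fun s => planeRot s x :=
    continuous_planeRot_comp continuous_id continuous_const
  have hdisk : (unitDisk : Set Plane) ⊆ closedBall 0 1 := ball_subset_closedBall
  have hintc {g : Plane → ℝ} (hg : Continuous g) :
      Integrable g (volume.restrict (unitDisk : Set Plane)) :=
    (hg.continuousOn.integrableOn_compact (isCompact_closedBall 0 1)).mono_set hdisk
  have hGint : Integrable (Function.uncurry fun s x => G (planeRot s x))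
      ((volume.restrict (uIoc 0 a)).prod (volume.restrict (unitDisk : Set Plane))) := by
    rw [Measure.prod_restrict]
    have hc : Continuous (Function.uncurry fun s x => G (planeRot s x)) :=
      hGc.comp (continuous_planeRot_comp continuous_fst continuous_snd)
    refine IntegrableOn.mono_set (hc.continuousOn.integrableOn_compact
      ((isCompact_uIcc (a := 0) (b := a)).prod (isCompact_closedBall (0 : Plane) 1))) ?_
    exact prod_mono uIoc_subset_uIcc hdisk
  have hpt : ∀ x ∈ (unitDisk : Set Plane), ‖φ (planeRot a x) - φ x‖ ^ 2
      ≤ a * ∫ s in (0 : ℝ)..a, G (planeRot s x) := by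
    intro x hx
    have hx1 : ‖x‖ ≤ 1 := by simpa using hdisk hx
    choose v hv hd using fun s => exists_hasDerivAt_planeRot s x
    have hder (s : ℝ) : HasDerivAt (fun t => φ (planeRot t x)) (fderiv ℝ φ (planeRot s x) (v s)) s :=
      ((hφ.differentiable (by simp) _).hasFDerivAt).comp_hasDerivAt s (hd s)
    have hle (s : ℝ) : ‖fderiv ℝ φ (planeRot s x) (v s)‖ ≤ √(G (planeRot s x)) := by
      refine Real.le_sqrt_of_sq_le ((norm_map_sq_le _ _).trans ?_)
      rw [hv]
      refine mul_le_of_le_one_left (Finset.sum_nonneg fun i _ => sq_nonneg _) ?_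
      exact pow_le_one₀ (norm_nonneg _) hx1
    have hsc : Continuous fun s => √(G (planeRot s x)) := (hGc.comp (hrot x)).sqrt
    have h1 : ‖φ (planeRot a x) - φ (planeRot 0 x)‖ ≤ ∫ s in (0 : ℝ)..a, √(G (planeRot s x)) := by
      have hB (s : ℝ) : HasDerivAt (fun t => ∫ r in (0 : ℝ)..t, √(G (planeRot r x)))
          (√(G (planeRot s x))) s :=
        intervalIntegral.integral_hasDerivAt_right (hsc.intervalIntegrable _ _)
          (hsc.stronglyMeasurableAtFilter _ _) hsc.continuousAt
      refine image_norm_le_of_norm_deriv_right_le_deriv_boundary (a := 0) (b := a)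
        (f := fun t => φ (planeRot t x) - φ (planeRot 0 x))
        (f' := fun s => fderiv ℝ φ (planeRot s x) (v s)) ?_ ?_ ?_ hB ?_ ⟨ha, le_rfl⟩
      · exact fun s _ => ((hder s).sub_const _).continuousAt.continuousWithinAt
      · exact fun s _ => ((hder s).sub_const _).hasDerivWithinAt
      · simp
      · exact fun s _ => hle s
    have h0 : planeRot 0 x = x := by
      apply planeComplex.injective
      rw [planeComplex_rot]
      simp
    rw [h0] at h1
    refine (pow_le_pow_left₀ (norm_nonneg _) h1 2).trans ?_
    refine (sq_intervalIntegral_le ha hsc).trans (le_of_eq ?_)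
    congr 1
    refine intervalIntegral.integral_congr fun s _ => ?_
    exact Real.sq_sqrt (Finset.sum_nonneg fun i _ => sq_nonneg _)
  have hswap := intervalIntegral_integral_swap hGint
  have hinv (s : ℝ) : ∫ x in (unitDisk : Set Plane), G (planeRot s x)
      = ∫ x in (unitDisk : Set Plane), G x :=
    (measurePreserving_planeRot s).integral_comp
      (planeRot s).toHomeomorph.measurableEmbedding G
  have hint2 : Integrable (fun x => ∫ s in (0 : ℝ)..a, G (planeRot s x))
      (volume.restrict (unitDisk : Set Plane)) := by
    have hc : Continuous (Function.uncurry fun x s => G (planeRot s x)) :=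
      hGc.comp (continuous_planeRot_comp continuous_snd continuous_fst)
    exact hintc (intervalIntegral.continuous_parametric_intervalIntegral_of_continuous' hc 0 a)
  calc ∫ x in (unitDisk : Set Plane), ‖φ (planeRot a x) - φ x‖ ^ 2
      ≤ ∫ x in (unitDisk : Set Plane), a * ∫ s in (0 : ℝ)..a, G (planeRot s x) := by
        refine integral_mono_ae (hintc ?_) (hint2.const_mul a) ?_
        · exact (((hφ.continuous.comp (planeRot a).continuous).sub hφ.continuous).norm.pow 2)
        · filter_upwards [ae_restrict_mem unitDisk.isOpen.measurableSet] with x hx using hpt x hx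
    _ = a ^ 2 * ∫ x in (unitDisk : Set Plane), G x := by
        rw [integral_const_mul, ← hswap]
        simp only [hinv, intervalIntegral.integral_const, sub_zero, smul_eq_mul]
        ring

/-- The pairs `(φ, ∇φ)` with `φ` smooth on the closed disk. -/
def smoothJets : Set (L2 unitDisk × (Fin 2 → L2 unitDisk)) :=
  {U | ∃ φ : Plane → ℂ, ContDiff ℝ ∞ φ ∧ U.1 =ᵐ[volume.restrict (unitDisk : Set Plane)] φ ∧
    ∀ i, U.2 i =ᵐ[volume.restrict (unitDisk : Set Plane)] fun x => fderiv ℝ φ x (planeFrame i)}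

/-- Both sides are continuous in the jet. The closure of `smoothJets` contains the jets from the
Dirichlet domain and those from the Robin domain, so one inequality serves both operators. -/
lemma norm_diskRot_sub_sq_le_of_mem_closure {a : ℝ} (ha : 0 ≤ a)
    {U : L2 unitDisk × (Fin 2 → L2 unitDisk)} (hU : U ∈ closure smoothJets) :
    ‖diskRot a U.1 - U.1‖ ^ 2 ≤ a ^ 2 * ∑ i, ‖U.2 i‖ ^ 2 := by
  refine closure_minimal (t := {U : L2 unitDisk × (Fin 2 → L2 unitDisk) |
    ‖diskRot a U.1 - U.1‖ ^ 2 ≤ a ^ 2 * ∑ i, ‖U.2 i‖ ^ 2}) ?_ ?_ hU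
  · rintro U ⟨φ, hφ, h, h'⟩
    have e1 : ‖diskRot a U.1 - U.1‖ ^ 2
        = ∫ x in (unitDisk : Set Plane), ‖φ (planeRot a x) - φ x‖ ^ 2 := by
      rw [L2_norm_sq_eq]
      refine integral_congr_ae ?_
      filter_upwards [Lp.coeFn_sub (diskRot a U.1) U.1, coeFn_diskRot a U.1, h,
        (measurePreserving_planeRot a).quasiMeasurePreserving.ae h] with x h₁ h₂ h₃ h₄
      rw [h₁, Pi.sub_apply, h₂, h₃, h₄]
    have e2 : ∑ i, ‖U.2 i‖ ^ 2
        = ∫ x in (unitDisk : Set Plane), ∑ i, ‖fderiv ℝ φ x (planeFrame i)‖ ^ 2 := by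
      rw [integral_finsetSum]
      · refine Finset.sum_congr rfl fun i _ => ?_
        rw [L2_norm_sq_eq]
        refine integral_congr_ae ?_
        filter_upwards [h' i] with x hx
        rw [hx]
      · intro i _
        have h2 := (Lp.memLp (U.2 i)).integrable_norm_pow (by norm_num)
        refine h2.congr ?_
        filter_upwards [h' i] with x hx
        rw [hx]
    change ‖diskRot a U.1 - U.1‖ ^ 2 ≤ _
    rw [e1, e2]
    exact integral_rot_sub_sq_le hφ ha
  · refine isClosed_le ?_ ?_
    · exact (((diskRot a).continuous.comp continuous_fst).sub continuous_fst).norm.pow 2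
    · refine continuous_const.mul (continuous_finsetSum _ fun i _ => ?_)
      exact ((continuous_apply i).comp continuous_snd).norm.pow 2

lemma jet_mem_closure_of_mem_sobolevH10 {u : L2 unitDisk}
    (hu : u ∈ sobolevH10 unitDisk planeFrame) :
    jet unitDisk planeFrame u ∈ closure smoothJets := by
  refine closure_mono ?_ hu.2
  rintro U ⟨φ, h, h'⟩
  exact ⟨φ, φ.contDiff, h, h'⟩

lemma HasTrace.jet_mem_closure {u : L2 unitDisk} {g : Lp ℂ 2 arcLength} (h : HasTrace u g) :
    jet unitDisk planeFrame u ∈ closure smoothJets := by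
  refine map_mem_closure (f := fun T : (L2 unitDisk × (Fin 2 → L2 unitDisk)) × Lp ℂ 2 arcLength =>
    T.1) continuous_fst h.2 ?_
  rintro T ⟨φ, hφ, h₁, h₂, -⟩
  exact ⟨φ, hφ, h₁, h₂⟩

/-- The `L²` functions on the disk that change sign under the rotation by `s`. -/
def antiInvariant (s : ℝ) : Submodule ℂ (L2 unitDisk) where
  carrier := {u | diskRot s u = -u}
  add_mem' := by
    intro u v hu hv
    simp only [mem_ofPred_eq] at hu hv ⊢
    rw [map_add, hu, hv, neg_add]
  zero_mem' := by simp
  smul_mem' := by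
    intro c u hu
    simp only [mem_ofPred_eq] at hu ⊢
    rw [map_smul, hu, smul_neg]

lemma mem_antiInvariant {s : ℝ} {u : L2 unitDisk} : u ∈ antiInvariant s ↔ diskRot s u = -u :=
  Iff.rfl

lemma isClosed_antiInvariant (s : ℝ) : IsClosed (antiInvariant s : Set (L2 unitDisk)) :=
  isClosed_eq (diskRot s).continuous continuous_neg

/-- The Poincaré inequality for functions that change sign under a rotation by a small angle. -/
lemma norm_sq_le_of_mem_antiInvariant {s : ℝ} (hs : 0 ≤ s) {u : L2 unitDisk}
    (hu : u ∈ antiInvariant s) (hj : jet unitDisk planeFrame u ∈ closure smoothJets) :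
    4 * ‖u‖ ^ 2 ≤ s ^ 2 * ∑ i, ‖weakDeriv unitDisk (planeFrame i) u‖ ^ 2 := by
  have h := norm_diskRot_sub_sq_le_of_mem_closure hs hj
  have e : diskRot s (jet unitDisk planeFrame u).1 - (jet unitDisk planeFrame u).1
      = (-2 : ℂ) • u := by
    change diskRot s u - u = _
    rw [mem_antiInvariant.1 hu]
    module
  rw [e, norm_smul, mul_pow] at h
  norm_num at h
  rw [Fin.sum_univ_two]
  exact h

/-- Only g has to lie in the sector: since rotation is unitary and negates g, pairing the rotated g
with the increment of u gives 2⟪g, u⟫. Hence it is never necessary to know that the Robin resolvent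
commutes with rotations. -/
lemma norm_inner_le_of_mem_antiInvariant {s : ℝ} (hs : 0 ≤ s) {g u : L2 unitDisk}
    (hg : g ∈ antiInvariant s) (hj : jet unitDisk planeFrame u ∈ closure smoothJets) :
    2 * ‖⟪g, u⟫_ℂ‖ ≤ s * ‖g‖ * √(∑ i, ‖weakDeriv unitDisk (planeFrame i) u‖ ^ 2) := by
  have h := norm_diskRot_sub_sq_le_of_mem_closure hs hj
  have h' : ‖diskRot s u - u‖ ≤ s * √(∑ i, ‖weakDeriv unitDisk (planeFrame i) u‖ ^ 2) := by
    refine (sq_le_sq₀ (norm_nonneg _) (by positivity)).1 ?_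
    rw [mul_pow, Real.sq_sqrt (Finset.sum_nonneg fun i _ => sq_nonneg _)]
    exact h
  have e : ⟪diskRot s g, diskRot s u - u⟫_ℂ = 2 * ⟪g, u⟫_ℂ := by
    rw [inner_sub_right, (diskRot s).inner_map_map, mem_antiInvariant.1 hg, inner_neg_left]
    ring
  have h2 := norm_inner_le_norm (𝕜 := ℂ) (diskRot s g) (diskRot s u - u)
  rw [e, norm_mul, (diskRot s).norm_map] at h2
  simp only [RCLike.norm_ofNat] at h2
  refine h2.trans ?_
  calc ‖g‖ * ‖diskRot s u - u‖ ≤ ‖g‖ * (s * √(∑ i, ‖weakDeriv unitDisk (planeFrame i) u‖ ^ 2)) :=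
        mul_le_mul_of_nonneg_left h' (norm_nonneg _)
    _ = _ := by ring

end Poincare

/-! ### Symmetric operators with a small resolvent on an invariant subspace -/

section Abstract

variable {H : Type*} [NormedAddCommGroup H] [InnerProductSpace ℂ H] [CompleteSpace H]

/-- Solve (1 + iR)w = u in K by a Neumann series and put v = Rw; then Av = w + iRw = u. The norm
bound follows from ‖Rw‖ ≤ ‖w‖/2 ≤ (‖u‖ + ‖Rw‖)/2. -/
lemma exists_apply_eq_of_resolvent_small {A : H →ₗ.[ℂ] H} {R : H →L[ℂ] H}
    (hR : IsResolventAt A Complex.I R) {K : Submodule ℂ H} (hK : IsClosed (K : Set H))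
    (hRK : ∀ f ∈ K, R f ∈ K) (hs : ∀ f ∈ K, ‖R f‖ ≤ 1 / 2 * ‖f‖) {u : H} (hu : u ∈ K) :
    ∃ v : A.domain, (v : H) ∈ K ∧ A v = u ∧ ‖(v : H)‖ ≤ ‖u‖ := by
  have : CompleteSpace K := hK.completeSpace_coe
  set T : K →L[ℂ] K := (R ∘L K.subtypeL).codRestrict K fun f => hRK f f.2 with hT
  have hTn : ‖(-Complex.I) • T‖ ≤ 1 / 2 := by
    refine ContinuousLinearMap.opNorm_le_bound _ (by norm_num) fun f => ?_
    change ‖(-Complex.I) • R f‖ ≤ _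
    rw [norm_smul, norm_neg, Complex.norm_I, one_mul]
    exact hs f f.2
  have hT1 : ‖(-Complex.I) • T‖ < 1 := hTn.trans_lt (by norm_num)
  obtain ⟨B, hB⟩ := isUnit_one_sub_of_norm_lt_one (R := K →L[ℂ] K) hT1
  set w : K := (B⁻¹ : (K →L[ℂ] K)ˣ).1 ⟨u, hu⟩ with hw
  have hwu : (w : H) + Complex.I • R w = u := by
    have h1 : (B : K →L[ℂ] K) w = ⟨u, hu⟩ := by
      rw [hw, ← mul_apply_eq_comp, Units.mul_inv, one_apply_eq_self]
    rw [hB] at h1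
    have h2 : (w : H) - (-Complex.I) • R w = u := congrArg Subtype.val h1
    rwa [neg_smul, sub_neg_eq_add] at h2
  obtain ⟨h, hA⟩ := hR.1 w
  refine ⟨⟨R w, h⟩, hRK _ w.2, ?_, ?_⟩
  · rw [← hwu, eq_add_of_sub_eq hA]
  · have h1 := hs w w.2
    have h2 : ‖(w : H)‖ ≤ ‖u‖ + ‖R w‖ := by
      have : (w : H) = u - Complex.I • R w := eq_sub_of_add_eq hwu
      calc ‖(w : H)‖ = ‖u - Complex.I • R w‖ := by rw [← this]
        _ ≤ ‖u‖ + ‖Complex.I • R w‖ := norm_sub_le _ _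
        _ = ‖u‖ + ‖R w‖ := by rw [norm_smul, Complex.norm_I, one_mul]
    change ‖R w‖ ≤ ‖u‖
    linarith

/-- If a symmetric operator is nonnegative on an invariant subspace and its resolvent at `i` is
small there, then the operator is bounded below by `1` on this subspace. -/
lemma norm_sq_le_re_inner_of_nonneg {A : H →ₗ.[ℂ] H} {R : H →L[ℂ] H}
    (hR : IsResolventAt A Complex.I R) {K : Submodule ℂ H} (hK : IsClosed (K : Set H))
    (hRK : ∀ f ∈ K, R f ∈ K) (hs : ∀ f ∈ K, ‖R f‖ ≤ 1 / 2 * ‖f‖)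
    (hsymm : ∀ u v : A.domain, ⟪A u, (v : H)⟫_ℂ = ⟪(u : H), A v⟫_ℂ)
    (hpos : ∀ u : A.domain, (u : H) ∈ K → 0 ≤ (⟪(u : H), A u⟫_ℂ).re) (u : A.domain)
    (hu : (u : H) ∈ K) : ‖(u : H)‖ ^ 2 ≤ (⟪(u : H), A u⟫_ℂ).re := by
  obtain ⟨v, hvK, hAv, hv⟩ := exists_apply_eq_of_resolvent_small hR hK hRK hs hu
  -- With Av = u, symmetry gives ⟪u - v, A(u - v)⟫ = ⟪u, Au⟫ - 2‖u‖² + ⟪v, u⟫, and the real part of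
  -- the last term is at most ‖u‖². Nonnegativity at u - v is thus the claimed bound at u.
  have h := hpos (u - v) (sub_mem hu hvK)
  have huu : ⟪(u : H), (u : H)⟫_ℂ = ((‖(u : H)‖ ^ 2 : ℝ) : ℂ) := by
    rw [Complex.ofReal_pow]
    exact inner_self_eq_norm_sq_to_K _
  have e : ⟪((u - v : A.domain) : H), A (u - v)⟫_ℂ
      = ⟪(u : H), A u⟫_ℂ - 2 * ((‖(u : H)‖ ^ 2 : ℝ) : ℂ) + ⟪(v : H), (u : H)⟫_ℂ := by
    rw [LinearPMap.map_sub, Submodule.coe_sub, hAv, inner_sub_left, inner_sub_right,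
      inner_sub_right, ← hsymm v u, hAv, huu]
    ring
  rw [e] at h
  have h2 : (⟪(v : H), (u : H)⟫_ℂ).re ≤ ‖(u : H)‖ ^ 2 := by
    refine (Complex.re_le_norm _).trans ((norm_inner_le_norm _ _).trans ?_)
    rw [sq]
    exact mul_le_mul_of_nonneg_right hv (norm_nonneg _)
  simp only [Complex.add_re, Complex.sub_re, Complex.mul_re, Complex.re_ofNat, Complex.im_ofNat,
    Complex.ofReal_re, Complex.ofReal_im] at h
  linarith

end Abstract

/-! ### The resolvent of the Robin Laplacian -/

section Robin

lemma jet_mem_closure_of_mem_robinDomain {u : L2 unitDisk} (hu : u ∈ robinDomain) :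
    jet unitDisk planeFrame u ∈ closure smoothJets := by
  obtain ⟨-, g, -, hg, -⟩ := hu
  exact hg.jet_mem_closure

/-- An everywhere defined bounded operator with range in `H¹` is bounded as an operator to `H¹`. -/
lemma exists_jet_bound {S : L2 unitDisk →L[ℂ] L2 unitDisk}
    (hS : ∀ f, S f ∈ sobolevH1 unitDisk planeFrame) :
    ∃ C, 0 ≤ C ∧ ∀ f, √(∑ i, ‖weakDeriv unitDisk (planeFrame i) (S f)‖ ^ 2) ≤ C * ‖f‖ := by
  let L (i : Fin 2) : L2 unitDisk →ₗ[ℂ] L2 unitDisk :=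
    { toFun := fun f => weakDeriv unitDisk (planeFrame i) (S f)
      map_add' := fun f g => by rw [map_add, weakDeriv_add (hS f) (hS g)]
      map_smul' := fun c f => by rw [map_smul, weakDeriv_smul c (hS f), RingHom.id_apply] }
  have hL (i : Fin 2) : Continuous (L i) := by
    -- Closed graph theorem: a limit of weak derivatives is the weak derivative of the limit.
    refine (L i).continuous_of_seq_closed_graph fun u x y hu hy => ?_
    have h1 : Tendsto (fun n => (S (u n), L i (u n))) atTop (𝓝 (S x, y)) :=
      ((S.continuous.tendsto x).comp hu).prodMk_nhds hy
    have h2 := (isClosed_hasWeakDeriv unitDisk (planeFrame i)).mem_of_tendsto h1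
      (Eventually.of_forall fun n => hasWeakDeriv_weakDeriv (hS (u n)) i)
    exact (weakDeriv_eq h2).symm
  let M (i : Fin 2) : L2 unitDisk →L[ℂ] L2 unitDisk := ⟨L i, hL i⟩
  refine ⟨√(∑ i, ‖M i‖ ^ 2), Real.sqrt_nonneg _, fun f => ?_⟩
  refine Real.sqrt_le_iff.2 ⟨by positivity, ?_⟩
  rw [mul_pow, Real.sq_sqrt (Finset.sum_nonneg fun i _ => sq_nonneg _), Finset.sum_mul]
  refine Finset.sum_le_sum fun i _ => ?_
  rw [← mul_pow]
  exact pow_le_pow_left₀ (norm_nonneg _) ((M i).le_opNorm f) 2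

end Robin

/-! ### The scaled potential -/

section Potential

namespace HalfLinePotential

lemma infDist_sphere_eq {x : Plane} (hx : x ∈ (unitDisk : Set Plane)) :
    infDist x (sphere (0 : Plane) 1) = 1 - ‖x‖ := by
  have hx1 : ‖x‖ < 1 := by simpa [unitDisk] using hx
  have hne : (sphere (0 : Plane) 1).Nonempty := ⟨planeFrame 0, by simp [planeFrame]⟩
  refine le_antisymm ?_ ?_
  · by_cases h0 : x = 0
    · have h : planeFrame 0 ∈ sphere (0 : Plane) 1 := by simp [planeFrame]
      refine (infDist_le_dist_of_mem h).trans ?_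
      simp [h0, planeFrame]
    · have hn : ‖x‖ ≠ 0 := norm_ne_zero_iff.2 h0
      have h : ‖x‖⁻¹ • x ∈ sphere (0 : Plane) 1 := by
        simp [norm_smul, hn]
      refine (infDist_le_dist_of_mem h).trans (le_of_eq ?_)
      have e : x - ‖x‖⁻¹ • x = (1 - ‖x‖⁻¹) • x := by module
      have h1 : 1 ≤ ‖x‖⁻¹ := (one_le_inv₀ (norm_pos_iff.2 h0)).2 hx1.le
      rw [dist_eq_norm, e, norm_smul, Real.norm_eq_abs, abs_sub_comm,
        abs_of_nonneg (by linarith), sub_mul, inv_mul_cancel₀ hn, one_mul]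
  · refine (le_infDist hne).2 fun {y} hy => ?_
    have hy1 : ‖y‖ = 1 := by simpa using hy
    rw [dist_comm, dist_eq_norm, ← hy1]
    exact norm_sub_norm_le y x

variable (V : HalfLinePotential)

lemma coeFn_scaledPotential (ε : Ioi (0 : ℝ)) :
    V.scaledPotential ε =ᵐ[volume.restrict (unitDisk : Set Plane)]
      fun x => ((1 / (ε : ℝ) ^ 2 * V ((1 - ‖x‖) / ε) : ℝ) : ℂ) := by
  have h : V.scaledPotential ε =ᵐ[volume.restrict (unitDisk : Set Plane)]
      fun x => ((1 / (ε : ℝ) ^ 2 * V (infDist x (sphere (0 : Plane) 1) / ε) : ℝ) : ℂ) :=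
    MemLp.coeFn_toLp _
  filter_upwards [h, ae_restrict_mem unitDisk.isOpen.measurableSet] with x h₁ h₂
  rw [h₁, infDist_sphere_eq h₂]

lemma scaledPotential_rot (ε : Ioi (0 : ℝ)) (s : ℝ) :
    ∀ᵐ x ∂(volume.restrict (unitDisk : Set Plane)),
      V.scaledPotential ε (planeRot s x) = V.scaledPotential ε x := by
  filter_upwards [V.coeFn_scaledPotential ε, (measurePreserving_planeRot s).quasiMeasurePreserving.ae
    (V.coeFn_scaledPotential ε)] with x h₁ h₂
  rw [h₁, h₂, LinearIsometryEquiv.norm_map]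

lemma scaledPotential_conj (ε : Ioi (0 : ℝ)) :
    ∀ᵐ x ∂(volume.restrict (unitDisk : Set Plane)),
      starRingEnd ℂ (V.scaledPotential ε x) = V.scaledPotential ε x := by
  filter_upwards [V.coeFn_scaledPotential ε] with x h₁
  rw [h₁, Complex.conj_ofReal]

/-- The values of V at negative arguments are unconstrained; freezing them at V 0 gives a globally
continuous function with the same values on [0, ∞). -/
lemma continuous_comp_max : Continuous fun t : ℝ => V (max t 0) :=
  V.smooth.continuousOn.comp_continuous (by fun_prop) fun t => le_max_right t 0

/-- The scaled potential depends continuously on `ε` in the `L^∞` norm. -/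
lemma eventually_norm_scaledPotential_sub_le (ε : Ioi (0 : ℝ)) {c : ℝ} (hc : 0 < c) :
    ∀ᶠ η in 𝓝 ε, ‖V.scaledPotential η - V.scaledPotential ε‖ ≤ c := by
  -- The second variable is the distance to the circle; its range lies in a compact interval, so
  -- joint continuity gives uniform convergence.
  let F : Ioi (0 : ℝ) → Icc (0 : ℝ) 1 → ℝ := fun η t =>
    1 / (η : ℝ) ^ 2 * V (max ((t : ℝ) / η) 0)
  have hF : Continuous (Function.uncurry F) := by
    have h1 : Continuous fun p : Ioi (0 : ℝ) × Icc (0 : ℝ) 1 => (p.1 : ℝ) :=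
      continuous_subtype_val.comp continuous_fst
    have h2 : Continuous fun p : Ioi (0 : ℝ) × Icc (0 : ℝ) 1 => (p.2 : ℝ) :=
      continuous_subtype_val.comp continuous_snd
    have h0 : ∀ p : Ioi (0 : ℝ) × Icc (0 : ℝ) 1, (p.1 : ℝ) ≠ 0 := fun p => ne_of_gt p.1.2
    exact (continuous_const.div (h1.fun_pow 2) fun p => pow_ne_zero 2 (h0 p)).mul
      (V.continuous_comp_max.comp (h2.div h1 h0))
  have : LocallyCompactSpace (Ioi (0 : ℝ)) := isOpen_Ioi.locallyCompactSpace
  have hu := Continuous.tendstoUniformly F hF ε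
  filter_upwards [Metric.tendstoUniformly_iff.1 hu c hc] with η hη
  rw [Lp.norm_def]
  refine ENNReal.toReal_le_of_le_ofReal hc.le ?_
  rw [eLpNorm_exponent_top]
  refine eLpNormEssSup_le_of_ae_bound ?_
  filter_upwards [Lp.coeFn_sub (V.scaledPotential η) (V.scaledPotential ε),
    V.coeFn_scaledPotential η, V.coeFn_scaledPotential ε,
    ae_restrict_mem unitDisk.isOpen.measurableSet] with x h₁ h₂ h₃ h₄
  have hx1 : ‖x‖ < 1 := by simpa [unitDisk] using h₄
  have hp (ζ : Ioi (0 : ℝ)) : max ((1 - ‖x‖) / (ζ : ℝ)) 0 = (1 - ‖x‖) / ζ :=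
    max_eq_left (div_nonneg (by linarith) (le_of_lt ζ.2))
  have h := hη ⟨1 - ‖x‖, by linarith, by linarith [norm_nonneg x]⟩
  rw [h₁, Pi.sub_apply, h₂, h₃, ← Complex.ofReal_sub, Complex.norm_real, ← dist_eq_norm, dist_comm]
  simp only [F, hp] at h
  exact h.le

/-! ### Quadratic form and symmetry of the disk operators. -/

lemma mem_diskOperator_domain {ε : Ioi (0 : ℝ)} {u : L2 unitDisk} :
    u ∈ (V.diskOperator ε).domain ↔
      u ∈ sobolevH10 unitDisk planeFrame ∧ u ∈ sobolevH2 unitDisk planeFrame := Iff.rfl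

lemma inner_diskOperator (ε : Ioi (0 : ℝ)) (u : (V.diskOperator ε).domain) :
    (⟪(u : L2 unitDisk), V.diskOperator ε u⟫_ℂ).re
      = ∑ i, ‖weakDeriv unitDisk (planeFrame i) u‖ ^ 2
        + (⟪(u : L2 unitDisk), (V.scaledPotential ε • (u : L2 unitDisk) : L2 unitDisk)⟫_ℂ).re := by
  have h := inner_dirichletSchrodinger (W := V.scaledPotential ε) u u
  refine (congrArg Complex.re h).trans ?_
  rw [Complex.add_re, Complex.re_sum]
  congr 1
  refine Finset.sum_congr rfl fun i _ => ?_
  rw [inner_self_eq_norm_sq_to_K]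
  norm_cast

lemma diskOperator_symm (ε : Ioi (0 : ℝ)) (u v : (V.diskOperator ε).domain) :
    ⟪V.diskOperator ε u, (v : L2 unitDisk)⟫_ℂ = ⟪(u : L2 unitDisk), V.diskOperator ε v⟫_ℂ :=
  dirichletSchrodinger_symm (V.scaledPotential_conj ε) u v

/-! ### Persistence of the lower bound on a sector. -/

lemma resolvent_mem_antiInvariant {ε : Ioi (0 : ℝ)} {z : ℂ} {R : L2 unitDisk →L[ℂ] L2 unitDisk}
    (hR : IsResolventAt (V.diskOperator ε) z R) (s : ℝ) {f : L2 unitDisk}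
    (hf : f ∈ antiInvariant s) : R f ∈ antiInvariant s := by
  have h := IsResolventAt.diskRot_comm (V.scaledPotential_rot ε s) hR f
  rw [mem_antiInvariant] at hf ⊢
  rw [← h, hf, map_neg]

lemma abs_re_inner_lpSMul_le (W : Lp ℂ ∞ (volume.restrict (unitDisk : Set Plane)))
    (u : L2 unitDisk) : |(⟪u, (W • u : L2 unitDisk)⟫_ℂ).re| ≤ ‖W‖ * ‖u‖ ^ 2 := by
  refine (Complex.abs_re_le_norm _).trans ((norm_inner_le_norm _ _).trans ?_)
  calc ‖u‖ * ‖(W • u : L2 unitDisk)‖ ≤ ‖u‖ * (‖W‖ * ‖u‖) :=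
        mul_le_mul_of_nonneg_left (Lp.norm_smul_le W u) (norm_nonneg _)
    _ = ‖W‖ * ‖u‖ ^ 2 := by ring

/-- The operator `A_ε` is bounded below by `1` on the functions that change sign under the rotation
by `s`. -/
def BoundedBelow (s : ℝ) (ε : Ioi (0 : ℝ)) : Prop :=
  ∀ u : (V.diskOperator ε).domain, (u : L2 unitDisk) ∈ antiInvariant s →
    ‖(u : L2 unitDisk)‖ ^ 2 ≤ (⟪(u : L2 unitDisk), V.diskOperator ε u⟫_ℂ).re

/-- The two forms have the same gradient term and differ by at most ‖u‖², which is exactly what the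
lower bound at ε can absorb. -/
lemma re_inner_diskOperator_nonneg {ε η : Ioi (0 : ℝ)} (u : L2 unitDisk)
    (hu : u ∈ (V.diskOperator ε).domain) (hu' : u ∈ (V.diskOperator η).domain)
    (h : ‖u‖ ^ 2 ≤ (⟪u, V.diskOperator ε ⟨u, hu⟩⟫_ℂ).re)
    (hηε : ‖V.scaledPotential η - V.scaledPotential ε‖ ≤ 1) :
    0 ≤ (⟪u, V.diskOperator η ⟨u, hu'⟩⟫_ℂ).re := by
  have h2 := V.inner_diskOperator η ⟨u, hu'⟩
  have h3 := V.inner_diskOperator ε ⟨u, hu⟩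
  have h4 := abs_re_inner_lpSMul_le (V.scaledPotential η - V.scaledPotential ε) u
  have h5 : ((V.scaledPotential η - V.scaledPotential ε) • u : L2 unitDisk)
      = V.scaledPotential η • u - V.scaledPotential ε • u := by
    rw [sub_eq_add_neg, Lp.smul_add, Lp.neg_smul, sub_eq_add_neg]
  rw [h5, inner_sub_right, Complex.sub_re] at h4
  have h6 := (abs_le.1 h4).1
  have h7 : ‖V.scaledPotential η - V.scaledPotential ε‖ * ‖u‖ ^ 2 ≤ ‖u‖ ^ 2 :=
    mul_le_of_le_one_left (sq_nonneg _) hηε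
  rw [h2]
  rw [h3] at h
  linarith

/-- The change of potential lowers the bound from 1 to 0, and the small resolvent at η lifts it back
to 1. No loss accumulates, so the step can be iterated. -/
lemma boundedBelow_of_norm_sub_le {s : ℝ} {ε η : Ioi (0 : ℝ)} (h : V.BoundedBelow s ε)
    (hηε : ‖V.scaledPotential η - V.scaledPotential ε‖ ≤ 1)
    {R : L2 unitDisk →L[ℂ] L2 unitDisk} (hR : IsResolventAt (V.diskOperator η) Complex.I R)
    (hs : ∀ f ∈ antiInvariant s, ‖R f‖ ≤ 1 / 2 * ‖f‖) : V.BoundedBelow s η := by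
  intro u hu
  refine norm_sq_le_re_inner_of_nonneg hR (isClosed_antiInvariant s)
    (fun f hf => V.resolvent_mem_antiInvariant hR s hf) hs (V.diskOperator_symm η)
    (fun v hv => ?_) u hu
  have hv' : (v : L2 unitDisk) ∈ (V.diskOperator ε).domain :=
    V.mem_diskOperator_domain.2 (V.mem_diskOperator_domain.1 v.2)
  exact V.re_inner_diskOperator_nonneg v hv' v.2 (h ⟨v, hv'⟩ hv) hηε

/-- The Poincaré inequality bounds the kinetic energy below by (4/s²)‖u‖², which dominates a bounded
potential when s is small. -/
lemma boundedBelow_of_small_angle {s : ℝ} (hs : 0 < s) (ε : Ioi (0 : ℝ))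
    (h : s ^ 2 * (‖V.scaledPotential ε‖ + 1) ≤ 4) : V.BoundedBelow s ε := by
  intro u hu
  have h1 := norm_sq_le_of_mem_antiInvariant hs.le hu (jet_mem_closure_of_mem_sobolevH10 u.2.1)
  have h2 := (abs_le.1 (abs_re_inner_lpSMul_le (V.scaledPotential ε) u)).1
  rw [V.inner_diskOperator]
  set G := ∑ i, ‖weakDeriv unitDisk (planeFrame i) (u : L2 unitDisk)‖ ^ 2
  have h3 : s ^ 2 * ((‖V.scaledPotential ε‖ + 1) * ‖(u : L2 unitDisk)‖ ^ 2) ≤ s ^ 2 * G := by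
    refine le_trans ?_ h1
    rw [← mul_assoc]
    exact mul_le_mul_of_nonneg_right h (sq_nonneg _)
  have h4 := le_of_mul_le_mul_left h3 (by positivity)
  linarith

/-- The lower bound persists as long as the resolvents stay small. -/
lemma boundedBelow_of_le {s : ℝ} {ε₀ : Ioi (0 : ℝ)} (h₀ : V.BoundedBelow s ε₀)
    {R : Ioi (0 : ℝ) → L2 unitDisk →L[ℂ] L2 unitDisk}
    (hR : ∀ ε ≤ ε₀, IsResolventAt (V.diskOperator ε) Complex.I (R ε))
    (hs : ∀ ε ≤ ε₀, ∀ f ∈ antiInvariant s, ‖R ε f‖ ≤ 1 / 2 * ‖f‖) {ε : Ioi (0 : ℝ)}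
    (hε : ε ≤ ε₀) : V.BoundedBelow s ε := by
  have hconn : IsPreconnected (Icc ε ε₀) := by
    refine IsInducing.subtypeVal.isPreconnected_image.1 ?_
    have e : Subtype.val '' Icc ε ε₀ = Icc (ε : ℝ) ε₀ := by
      ext t
      constructor
      · rintro ⟨η, hη, rfl⟩
        exact hη
      · exact fun ht => ⟨⟨t, lt_of_lt_of_le ε.2 ht.1⟩, ht, rfl⟩
    rw [e]
    exact isPreconnected_Icc
  have : PreconnectedSpace (Icc ε ε₀) := isPreconnected_iff_preconnectedSpace.1 hconn
  -- The passage between nearby parameters works in both directions, so the bound holds on an open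
  -- and closed subset of a connected interval.
  have hloc : IsLocallyConstant fun η : Icc ε ε₀ => V.BoundedBelow s η := by
    rw [IsLocallyConstant.iff_eventually_eq]
    intro η
    have h := V.eventually_norm_scaledPotential_sub_le (η : Ioi (0 : ℝ)) one_pos
    filter_upwards [continuous_subtype_val.continuousAt.eventually h] with ζ hζ
    refine propext ⟨fun h => ?_, fun h => ?_⟩
    · exact V.boundedBelow_of_norm_sub_le h (by rwa [norm_sub_rev]) (hR η η.2.2) (hs η η.2.2)
    · exact V.boundedBelow_of_norm_sub_le h hζ (hR ζ ζ.2.2) (hs ζ ζ.2.2)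
  have e := hloc.apply_eq_of_preconnectedSpace ⟨ε₀, hε, le_rfl⟩ ⟨ε, le_rfl, hε⟩
  exact e.mp h₀

end HalfLinePotential

end Potential

/-! ### The quadratic form on test functions -/

section Form

variable {E : Type*} [NormedAddCommGroup E] [InnerProductSpace ℝ E] [FiniteDimensional ℝ E]
  [MeasurableSpace E] [BorelSpace E] {ι : Type*} [Fintype ι] {Ω : Opens E} {e : ι → E}

lemma continuous_lpSMul (W : Lp ℂ ∞ (volume.restrict (Ω : Set E))) :
    Continuous fun u : L2 Ω => (W • u : L2 Ω) := by
  refine LipschitzWith.continuous (K := ‖W‖₊) (LipschitzWith.of_dist_le_mul fun u v => ?_)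
  have h : (W • u : L2 Ω) - (W • v : L2 Ω) = W • (u - v) := by
    rw [sub_eq_add_neg u v, Lp.add_smul, Lp.smul_neg, sub_eq_add_neg]
  rw [dist_eq_norm, dist_eq_norm, h]
  exact Lp.norm_smul_le W (u - v)

lemma norm_testL2_sq (φ : 𝓓(Ω, ℂ)) : ‖testL2 φ‖ ^ 2 = ∫ x in (Ω : Set E), ‖φ x‖ ^ 2 := by
  rw [L2_norm_sq_eq]
  refine integral_congr_ae ?_
  filter_upwards [coeFn_testL2 φ] with x hx
  rw [hx]

lemma re_inner_lpSMul_testL2 {W : Lp ℂ ∞ (volume.restrict (Ω : Set E))} {w : E → ℝ}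
    (hW : W =ᵐ[volume.restrict (Ω : Set E)] fun x => (w x : ℂ)) (φ : 𝓓(Ω, ℂ)) :
    Integrable (fun x => w x * ‖φ x‖ ^ 2) (volume.restrict (Ω : Set E)) ∧
    (⟪testL2 φ, (W • testL2 φ : L2 Ω)⟫_ℂ).re = ∫ x in (Ω : Set E), w x * ‖φ x‖ ^ 2 := by
  have h : (fun x => (⟪testL2 φ x, (W • testL2 φ : L2 Ω) x⟫_ℂ).re)
      =ᵐ[volume.restrict (Ω : Set E)] fun x => w x * ‖φ x‖ ^ 2 := by
    filter_upwards [coeFn_testL2 φ, hW, Lp.coeFn_lpSMul (r := 2) W (testL2 φ)] with x h₁ h₂ h₃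
    rw [h₃, Pi.smul_apply', h₁, h₂, smul_eq_mul, RCLike.inner_apply, mul_assoc, Complex.mul_conj,
      ← Complex.ofReal_mul, Complex.ofReal_re, Complex.normSq_eq_norm_sq]
  have hi := L2.integrable_inner (𝕜 := ℂ) (testL2 φ) (W • testL2 φ : L2 Ω)
  refine ⟨hi.re.congr h, ?_⟩
  rw [L2.inner_def, ← integral_congr_ae h]
  exact (integral_re hi).symm

lemma form_testL2 {W : Lp ℂ ∞ (volume.restrict (Ω : Set E))} {w : E → ℝ}
    (hW : W =ᵐ[volume.restrict (Ω : Set E)] fun x => (w x : ℂ)) (φ : 𝓓(Ω, ℂ)) :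
    ∑ i, ‖testL2 (testDeriv (e i) φ)‖ ^ 2 + (⟪testL2 φ, (W • testL2 φ : L2 Ω)⟫_ℂ).re
      = ∫ x in (Ω : Set E), (∑ i, ‖fderiv ℝ φ x (e i)‖ ^ 2 + w x * ‖φ x‖ ^ 2) := by
  have hi (i : ι) : Integrable (fun x => ‖fderiv ℝ φ x (e i)‖ ^ 2)
      (volume.restrict (Ω : Set E)) :=
    (memLp_test (testDeriv (e i) φ)).integrable_norm_pow (by norm_num)
  rw [integral_add (integrable_finsetSum _ fun i _ => hi i) (re_inner_lpSMul_testL2 hW φ).1,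
    integral_finsetSum _ fun i _ => hi i, (re_inner_lpSMul_testL2 hW φ).2]
  simp only [norm_testL2_sq]
  rfl

/-- A Dirichlet Schrödinger operator with a negative eigenvalue has a negative quadratic form on
some test function. -/
lemma exists_test_form_neg {W : Lp ℂ ∞ (volume.restrict (Ω : Set E))} {w : E → ℝ}
    (hW : W =ᵐ[volume.restrict (Ω : Set E)] fun x => (w x : ℂ)) {μ : ℝ} (hμ : μ < 0)
    {f : (dirichletSchrodinger Ω e W).domain} (hf : f ≠ 0)
    (h : dirichletSchrodinger Ω e W f = (μ : ℂ) • (f : L2 Ω)) :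
    ∃ φ : 𝓓(Ω, ℂ), ∫ x in (Ω : Set E), (∑ i, ‖fderiv ℝ φ x (e i)‖ ^ 2 + w x * ‖φ x‖ ^ 2) < 0 := by
  let Q : L2 Ω × (ι → L2 Ω) → ℝ := fun U =>
    ∑ i, ‖U.2 i‖ ^ 2 + (⟪U.1, (W • U.1 : L2 Ω)⟫_ℂ).re
  have hQ : Continuous Q := by
    refine Continuous.add (continuous_finsetSum _ fun i _ => ?_) ?_
    · exact ((continuous_apply i).comp continuous_snd).norm.fun_pow 2
    · exact Complex.continuous_re.comp
        (continuous_fst.inner ((continuous_lpSMul W).comp continuous_fst))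
  -- At the eigenfunction the form equals μ‖f‖².
  have hQf : Q (jet Ω e f) < 0 := by
    have h1 := congrArg Complex.re (inner_dirichletSchrodinger f f)
    rw [h, inner_smul_right, inner_self_eq_norm_sq_to_K, Complex.add_re, Complex.re_sum] at h1
    have h2 : Q (jet Ω e f) = μ * ‖(f : L2 Ω)‖ ^ 2 := by
      have h3 : ((μ : ℂ) * ((‖(f : L2 Ω)‖ : ℝ) : ℂ) ^ 2).re = μ * ‖(f : L2 Ω)‖ ^ 2 := by
        norm_cast
      refine Eq.trans ?_ (h1.symm.trans h3)
      refine congrArg₂ (· + ·) (Finset.sum_congr rfl fun i _ => ?_) rfl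
      change ‖weakDeriv Ω (e i) (f : L2 Ω)‖ ^ 2 = _
      rw [inner_self_eq_norm_sq_to_K]
      norm_cast
    rw [h2]
    have h4 : 0 < ‖(f : L2 Ω)‖ := norm_pos_iff.2 fun h0 => hf (Subtype.ext h0)
    exact mul_neg_of_neg_of_pos hμ (by positivity)
  -- Negativity of the form is an open condition on jets, and the jet of f is a limit of test jets.
  obtain ⟨U, hU, hUt⟩ := mem_closure_iff.1 f.2.1.2 _ (isOpen_Iio.preimage hQ) hQf
  obtain ⟨φ, rfl⟩ := eq_testL2_of_mem_testJets hUt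
  refine ⟨φ, ?_⟩
  rw [← form_testL2 hW]
  exact hU

end Form

namespace HalfLinePotential

lemma HasNegativeEigenvalue.exists_test {V : HalfLinePotential} (h : V.HasNegativeEigenvalue) :
    ∃ φ : 𝓓(halfLine, ℂ), ∫ t in Ioi (0 : ℝ), (‖deriv φ t‖ ^ 2 + V t * ‖φ t‖ ^ 2) < 0 := by
  obtain ⟨μ, hμ, f, hf, h⟩ := h
  obtain ⟨φ, hφ⟩ := exists_test_form_neg (w := fun t => 1 * V t) (MemLp.coeFn_toLp _) hμ hf h
  refine ⟨φ, ?_⟩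
  simp only [Finset.univ_unique, Finset.sum_singleton, one_mul, fderiv_apply_one_eq_deriv] at hφ
  exact hφ

end HalfLinePotential

/-! ### Trial functions concentrated near the boundary circle -/

section Trial

/-- The bound a keeps the trial functions away from the boundary circle; b keeps them away from the
origin as soon as ε * b < 1. -/
lemma exists_support_bounds (φ : 𝓓(HalfLinePotential.halfLine, ℂ)) :
    ∃ a b : ℝ, 0 < a ∧ 0 < b ∧ tsupport φ ⊆ Icc a b := by
  have h0 : (0 : ℝ) ∈ (tsupport φ)ᶜ := fun h => lt_irrefl (0 : ℝ) (φ.tsupport_subset h)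
  obtain ⟨a, ha, hb⟩ := Metric.isOpen_iff.1 (isClosed_tsupport φ).isOpen_compl 0 h0
  obtain ⟨b, hb'⟩ := φ.hasCompactSupport.isCompact.isBounded.subset_closedBall 0
  refine ⟨a, max b 1, ha, by positivity, fun t ht => ⟨?_, ?_⟩⟩
  · have ht0 : 0 < t := φ.tsupport_subset ht
    by_contra hlt
    refine hb ?_ ht
    rw [mem_ball, Real.dist_eq, sub_zero, abs_of_pos ht0]
    exact not_le.1 hlt
  · have h := hb' ht
    rw [mem_closedBall, Real.dist_eq, sub_zero] at h
    exact ((le_abs_self t).trans h).trans (le_max_left _ _)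

/-- The function `z ↦ z^m φ((1 - |z|) / ε)`. -/
def trialFun (φ : ℝ → ℂ) (m : ℕ) (ε : ℝ) (x : Plane) : ℂ :=
  planeComplex x ^ m * φ ((1 - ‖x‖) / ε)

lemma tsupport_trialFun_subset {φ : ℝ → ℂ} {a b : ℝ} (h : tsupport φ ⊆ Icc a b) (m : ℕ)
    {ε : ℝ} (hε : 0 < ε) : tsupport (trialFun φ m ε) ⊆ {x | ‖x‖ ∈ Icc (1 - ε * b) (1 - ε * a)} := by
  refine closure_minimal (fun x hx => ?_) (isClosed_Icc.preimage continuous_norm)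
  have h1 : φ ((1 - ‖x‖) / ε) ≠ 0 := fun h0 => hx (by rw [trialFun, h0, mul_zero])
  have h2 := h (subset_tsupport φ h1)
  rw [mem_Icc, le_div_iff₀ hε, div_le_iff₀ hε] at h2
  exact ⟨by linarith [h2.2], by linarith [h2.1]⟩

/-- The norm is singular only at the origin, and the trial function vanishes near it because ε * b <
1. -/
lemma contDiff_trialFun {φ : ℝ → ℂ} (hφ : ContDiff ℝ ∞ φ) {a b : ℝ} (h : tsupport φ ⊆ Icc a b)
    (m : ℕ) {ε : ℝ} (hε : 0 < ε) (hb : ε * b < 1) : ContDiff ℝ ∞ (trialFun φ m ε) := by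
  rw [contDiff_iff_contDiffAt]
  intro x
  by_cases hx : x = 0
  · have h1 : x ∉ tsupport (trialFun φ m ε) := fun h2 => by
      have h3 := (tsupport_trialFun_subset h m hε h2).1
      rw [hx, norm_zero] at h3
      linarith
    exact contDiffAt_const.congr_of_eventuallyEq (notMem_tsupport_iff_eventuallyEq.1 h1)
  · have h1 : ContDiffAt ℝ ∞ (fun y : Plane => (1 - ‖y‖) / ε) x :=
      (contDiffAt_const.sub (contDiffAt_norm ℝ hx)).div_const ε
    exact (planeComplex.contDiff.contDiffAt.pow m).mul (hφ.contDiffAt.comp x h1)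

/-- The trial function as a test function on the disk. -/
def trialTest (φ : 𝓓(HalfLinePotential.halfLine, ℂ)) {a b : ℝ} (h : tsupport φ ⊆ Icc a b)
    (ha : 0 < a) (m : ℕ) {ε : ℝ} (hε : 0 < ε) (hb : ε * b < 1) : 𝓓(unitDisk, ℂ) where
  toFun := trialFun φ m ε
  contDiff' := contDiff_trialFun φ.contDiff h m hε hb
  hasCompactSupport' := by
    refine (isCompact_closedBall (0 : Plane) 1).of_isClosed_subset (isClosed_tsupport _)
      ((tsupport_trialFun_subset h m hε).trans fun x hx => ?_)
    have h1 : ‖x‖ ≤ 1 - ε * a := hx.2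
    have : 0 < ε * a := mul_pos hε ha
    simp only [mem_closedBall, dist_zero_right]
    linarith
  tsupport_subset' := by
    refine (tsupport_trialFun_subset h m hε).trans fun x hx => ?_
    have h1 : ‖x‖ ≤ 1 - ε * a := hx.2
    have : 0 < ε * a := mul_pos hε ha
    change x ∈ ball (0 : Plane) 1
    rw [mem_ball, dist_zero_right]
    linarith

/-- Rotation by π/m multiplies z^m by exp(iπ) = -1 and leaves the radial factor unchanged. -/
lemma testL2_trialTest_mem (φ : 𝓓(HalfLinePotential.halfLine, ℂ)) {a b : ℝ}
    (h : tsupport φ ⊆ Icc a b) (ha : 0 < a) {m : ℕ} (hm : m ≠ 0) {ε : ℝ} (hε : 0 < ε)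
    (hb : ε * b < 1) :
    testL2 (trialTest φ h ha m hε hb) ∈ antiInvariant (Real.pi / m) := by
  rw [mem_antiInvariant, diskRot_testL2]
  refine Lp.ext ?_
  filter_upwards [coeFn_testL2 (testRot (Real.pi / m) (trialTest φ h ha m hε hb)),
    coeFn_testL2 (trialTest φ h ha m hε hb), Lp.coeFn_neg (testL2 (trialTest φ h ha m hε hb))]
    with x h₁ h₂ h₃
  rw [h₁, h₃, Pi.neg_apply, h₂]
  change trialFun φ m ε (planeRot (Real.pi / m) x) = -trialFun φ m ε x
  have e : Complex.exp ((Real.pi / m : ℝ) * Complex.I) ^ m = -1 := by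
    rw [← Complex.exp_nat_mul, ← Complex.exp_pi_mul_I]
    congr 1
    have : (m : ℂ) ≠ 0 := Nat.cast_ne_zero.2 hm
    push_cast
    field_simp
  rw [trialFun, trialFun, LinearIsometryEquiv.norm_map, planeComplex_rot, mul_pow, e]
  ring

lemma hasFDerivAt_norm_plane {x : Plane} (hx : x ≠ 0) :
    HasFDerivAt (fun y : Plane => ‖y‖) (‖x‖⁻¹ • innerSL ℝ x) x := by
  have h := (hasStrictFDerivAt_norm_sq x).hasFDerivAt.sqrt (by simpa using hx)
  have h2 : ‖x‖ ≠ 0 := norm_ne_zero_iff.2 hx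
  simp only [Real.sqrt_sq (norm_nonneg _)] at h
  refine h.congr_fderiv (ContinuousLinearMap.ext fun v => ?_)
  simp only [FunLike.coe_smul, Pi.smul_apply, smul_eq_mul, nsmul_eq_mul]
  push_cast
  field_simp
  rfl

lemma fderiv_trialFun {φ : ℝ → ℂ} (hφ : Differentiable ℝ φ) (m : ℕ) (ε : ℝ) {x : Plane}
    (hx : x ≠ 0) (v : Plane) :
    fderiv ℝ (trialFun φ m ε) x v
      = m * planeComplex x ^ (m - 1) * planeComplex v * φ ((1 - ‖x‖) / ε)
        - ((inner ℝ x v / (‖x‖ * ε) : ℝ) : ℂ) * planeComplex x ^ m * deriv φ ((1 - ‖x‖) / ε) := by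
  have h1 : HasFDerivAt (fun y => planeComplex y)
      (planeComplex.toContinuousLinearEquiv : Plane →L[ℝ] ℂ) x :=
    (planeComplex.toContinuousLinearEquiv : Plane →L[ℝ] ℂ).hasFDerivAt
  have h2 : HasFDerivAt (fun y : Plane => (1 - ‖y‖) * ε⁻¹) _ x :=
    ((hasFDerivAt_norm_plane hx).const_sub 1).mul_const ε⁻¹
  simp only [← div_eq_mul_inv] at h2
  have h3 := (hφ ((1 - ‖x‖) / ε)).hasDerivAt.hasFDerivAt.comp x h2
  have h4 : HasFDerivAt (trialFun φ m ε) _ x := (h1.pow m).mul h3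
  rw [h4.fderiv]
  simp
  ring

/-- This is the squared gradient of the trial function at z, with p and q the values of φ and φ', M
= k + 1 and c = (|z|ε)⁻¹. Writing the power as k + 1 avoids a truncated subtraction; once z^k is
factored out, a polynomial identity remains. -/
lemma normSq_add_normSq (z p q : ℂ) (c : ℝ) (k : ℕ) (M : ℝ) :
    Complex.normSq (M * z ^ k * 1 * p - ((z.re * c : ℝ) : ℂ) * z ^ (k + 1) * q)
      + Complex.normSq (M * z ^ k * Complex.I * p - ((z.im * c : ℝ) : ℂ) * z ^ (k + 1) * q)
      = Complex.normSq z ^ k * (2 * M ^ 2 * Complex.normSq p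
        + Complex.normSq z ^ 2 * c ^ 2 * Complex.normSq q
        - 2 * M * c * Complex.normSq z * (p.re * q.re + p.im * q.im)) := by
  have e1 : (M * z ^ k * 1 * p - ((z.re * c : ℝ) : ℂ) * z ^ (k + 1) * q)
      = z ^ k * (M * p - ((z.re * c : ℝ) : ℂ) * z * q) := by ring
  have e2 : (M * z ^ k * Complex.I * p - ((z.im * c : ℝ) : ℂ) * z ^ (k + 1) * q)
      = z ^ k * (M * Complex.I * p - ((z.im * c : ℝ) : ℂ) * z * q) := by ring
  rw [e1, e2, map_mul, map_mul, map_pow, ← mul_add]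
  congr 1
  simp only [Complex.normSq_apply, Complex.sub_re, Complex.sub_im, Complex.mul_re, Complex.mul_im,
    Complex.ofReal_re, Complex.ofReal_im, Complex.I_re, Complex.I_im]
  ring

/-- The energy density of the trial function as a function of the radius. -/
def trialDensity (φ : ℝ → ℂ) (k : ℕ) (ε : ℝ) (w : ℝ → ℝ) (r : ℝ) : ℝ :=
  r ^ (2 * k) * (2 * (k + 1) ^ 2 * ‖φ ((1 - r) / ε)‖ ^ 2
      + r ^ 2 / ε ^ 2 * ‖deriv φ ((1 - r) / ε)‖ ^ 2
      - 2 * (k + 1) * r / ε * inner ℝ (φ ((1 - r) / ε)) (deriv φ ((1 - r) / ε))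
      + r ^ 2 / ε ^ 2 * w ((1 - r) / ε) * ‖φ ((1 - r) / ε)‖ ^ 2)

lemma density_trialFun {φ : ℝ → ℂ} (hφ : Differentiable ℝ φ) (k : ℕ) {ε : ℝ} (hε : 0 < ε)
    (w : ℝ → ℝ) {x : Plane} (hx : x ≠ 0) :
    ∑ i, ‖fderiv ℝ (trialFun φ (k + 1) ε) x (planeFrame i)‖ ^ 2
      + 1 / ε ^ 2 * w ((1 - ‖x‖) / ε) * ‖trialFun φ (k + 1) ε x‖ ^ 2
      = trialDensity φ k ε w ‖x‖ := by
  have hn : ‖x‖ ≠ 0 := norm_ne_zero_iff.2 hx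
  have hz : Complex.normSq (planeComplex x) = ‖x‖ ^ 2 := by
    rw [Complex.normSq_eq_norm_sq, LinearIsometryEquiv.norm_map]
  have i0 : inner ℝ x (planeFrame 0) = (planeComplex x).re := by
    rw [planeComplex_apply]
    simp [planeFrame, EuclideanSpace.inner_single_right]
  have i1 : inner ℝ x (planeFrame 1) = (planeComplex x).im := by
    rw [planeComplex_apply]
    simp [planeFrame, EuclideanSpace.inner_single_right]
  have h := normSq_add_normSq (planeComplex x) (φ ((1 - ‖x‖) / ε)) (deriv φ ((1 - ‖x‖) / ε))
    (‖x‖ * ε)⁻¹ k (k + 1)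
  rw [Fin.sum_univ_two, fderiv_trialFun hφ _ _ hx, fderiv_trialFun hφ _ _ hx, i0, i1,
    planeComplex_frame_zero, planeComplex_frame_one, ← Complex.normSq_eq_norm_sq,
    ← Complex.normSq_eq_norm_sq, Nat.add_sub_cancel, div_eq_mul_inv (planeComplex x).re,
    div_eq_mul_inv (planeComplex x).im]
  push_cast at h ⊢
  rw [h, hz, trialDensity, trialFun, norm_mul, norm_pow, LinearIsometryEquiv.norm_map,
    ← Complex.normSq_eq_norm_sq (deriv φ _), ← Complex.normSq_eq_norm_sq (φ _), Complex.inner,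
    mul_pow, ← Complex.normSq_eq_norm_sq (φ _)]
  simp only [Complex.mul_re, Complex.conj_re, Complex.conj_im]
  field_simp
  ring

/-- The rescaled radial energy density, which is regular at `ε = 0`. -/
def rescaledDensity (φ : ℝ → ℂ) (k : ℕ) (w : ℝ → ℝ) (ε t : ℝ) : ℝ :=
  (1 - ε * t) ^ (2 * k + 1) * (2 * (k + 1) ^ 2 * ε ^ 2 * ‖φ t‖ ^ 2
      + (1 - ε * t) ^ 2 * ‖deriv φ t‖ ^ 2
      - 2 * (k + 1) * (1 - ε * t) * ε * inner ℝ (φ t) (deriv φ t)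
      + (1 - ε * t) ^ 2 * w t * ‖φ t‖ ^ 2)

/-- The factor 1 - ε * t is the polar Jacobian r under the substitution r = 1 - εt; the whole
singularity in ε is the prefactor. -/
lemma rescaledDensity_eq (φ : ℝ → ℂ) (k : ℕ) (w : ℝ → ℝ) {ε : ℝ} (hε : 0 < ε) (t : ℝ) :
    (1 - ε * t) * trialDensity φ k ε w (1 - ε * t) = (ε ^ 2)⁻¹ * rescaledDensity φ k w ε t := by
  have h : (1 - (1 - ε * t)) / ε = t := by
    field_simp
    ring
  rw [trialDensity, rescaledDensity, h]
  field_simp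
  ring

end Trial

/-! ### Energy of the trial functions in polar coordinates. -/

section TrialEnergy

lemma eq_zero_and_deriv_eq_zero {φ : ℝ → ℂ} {a b : ℝ} (h : tsupport φ ⊆ Icc a b) {t : ℝ}
    (ht : t ∉ Icc a b) : φ t = 0 ∧ deriv φ t = 0 := by
  refine ⟨image_eq_zero_of_notMem_tsupport fun h1 => ht (h h1), ?_⟩
  by_contra h1
  exact ht (h (support_deriv_subset h1))

lemma trialDensity_eq_zero {φ : ℝ → ℂ} {a b : ℝ} (h : tsupport φ ⊆ Icc a b) (k : ℕ) (ε : ℝ)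
    (w : ℝ → ℝ) {r : ℝ} (hr : (1 - r) / ε ∉ Icc a b) : trialDensity φ k ε w r = 0 := by
  obtain ⟨h1, h2⟩ := eq_zero_and_deriv_eq_zero h hr
  simp [trialDensity, h1, h2]

lemma rescaledDensity_eq_zero {φ : ℝ → ℂ} {a b : ℝ} (h : tsupport φ ⊆ Icc a b) (k : ℕ)
    (w : ℝ → ℝ) (ε : ℝ) {t : ℝ} (ht : t ∉ Icc a b) : rescaledDensity φ k w ε t = 0 := by
  obtain ⟨h1, h2⟩ := eq_zero_and_deriv_eq_zero h ht
  simp [rescaledDensity, h1, h2]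

/-- Polar coordinates followed by r = 1 - εt: the prefactor ε⁻² of the density and dr = ε dt combine
to ε⁻¹. The constant is the circumference, expressed as the dimension times the volume of the ball.
-/
lemma integral_energy_trialFun {φ : ℝ → ℂ} (hφ : Differentiable ℝ φ) {a b : ℝ} (ha : 0 < a)
    (h : tsupport φ ⊆ Icc a b) (k : ℕ) {ε : ℝ} (hε : 0 < ε) (hb : ε * b < 1) (w : ℝ → ℝ) :
    ∫ x in (unitDisk : Set Plane),
        (∑ i, ‖fderiv ℝ (trialFun φ (k + 1) ε) x (planeFrame i)‖ ^ 2
          + 1 / ε ^ 2 * w ((1 - ‖x‖) / ε) * ‖trialFun φ (k + 1) ε x‖ ^ 2)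
      = 2 * (volume : Measure Plane).real (ball 0 1) * (ε⁻¹ * ∫ t in Icc a b, rescaledDensity φ k w ε t) := by
  have e1 : ∫ x in (unitDisk : Set Plane),
        (∑ i, ‖fderiv ℝ (trialFun φ (k + 1) ε) x (planeFrame i)‖ ^ 2
          + 1 / ε ^ 2 * w ((1 - ‖x‖) / ε) * ‖trialFun φ (k + 1) ε x‖ ^ 2)
      = ∫ x in (unitDisk : Set Plane), trialDensity φ k ε w ‖x‖ := by
    refine integral_congr_ae (ae_restrict_of_ae ?_)
    have h0 : ∀ᵐ x ∂(volume : Measure Plane), x ≠ 0 := Measure.ae_ne volume 0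
    filter_upwards [h0] with x hx using density_trialFun hφ k hε w hx
  have e2 : ∫ x in (unitDisk : Set Plane), trialDensity φ k ε w ‖x‖
      = ∫ x : Plane, trialDensity φ k ε w ‖x‖ := by
    refine setIntegral_eq_integral_of_forall_compl_eq_zero fun x hx => ?_
    have hx1 : 1 ≤ ‖x‖ := by
      by_contra hlt
      exact hx (by change x ∈ ball (0 : Plane) 1; simpa using hlt)
    refine trialDensity_eq_zero h k ε w fun ht => ?_
    have h1 : (1 - ‖x‖) / ε ≤ 0 := div_nonpos_of_nonpos_of_nonneg (by linarith) hε.le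
    linarith [ht.1]
  have e3 : ∫ y in Ioi (0 : ℝ), y * trialDensity φ k ε w y = ∫ y, y * trialDensity φ k ε w y := by
    refine setIntegral_eq_integral_of_forall_compl_eq_zero fun y hy => ?_
    rw [trialDensity_eq_zero h k ε w, mul_zero]
    intro ht
    have h1 := (div_le_iff₀ hε).1 ht.2
    have hy0 : y ≤ 0 := not_lt.1 hy
    linarith
  have e4 : ∫ y, y * trialDensity φ k ε w y = ε⁻¹ * ∫ t, rescaledDensity φ k w ε t := by
    have h1 := integral_sub_left_eq_self (fun y => y * trialDensity φ k ε w y) volume (1 : ℝ)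
    have h2 := Measure.integral_comp_mul_left
      (fun y : ℝ => (1 - y) * trialDensity φ k ε w (1 - y)) ε
    rw [h1, abs_of_pos (inv_pos.2 hε), smul_eq_mul] at h2
    simp only [rescaledDensity_eq φ k w hε] at h2
    rw [integral_const_mul] at h2
    have h3 : ∫ y, y * trialDensity φ k ε w y
        = ε * (ε⁻¹ * ∫ y, y * trialDensity φ k ε w y) := by
      rw [← mul_assoc, mul_inv_cancel₀ hε.ne', one_mul]
    rw [h3, ← h2, ← mul_assoc]
    congr 1
    field_simp
  have e5 : ∫ t in Icc a b, rescaledDensity φ k w ε t = ∫ t, rescaledDensity φ k w ε t :=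
    setIntegral_eq_integral_of_forall_compl_eq_zero fun t ht => rescaledDensity_eq_zero h k w ε ht
  have e6 := integral_fun_norm_addHaar (volume : Measure Plane) (fun r => trialDensity φ k ε w r)
  have hdim : Module.finrank ℝ Plane = 2 := by simp
  rw [hdim] at e6
  simp only [Nat.add_one_sub_one, pow_one, smul_eq_mul, nsmul_eq_mul, Nat.cast_ofNat] at e6
  rw [e1, e2, e6, e3, e4, e5, mul_assoc]

/-- At ε = 0 the terms depending on the angular momentum drop out and the half-line energy density
remains. The integral over the compact interval is continuous in ε, hence still negative nearby. -/
lemma eventually_integral_rescaledDensity_neg {φ : ℝ → ℂ} (hφ : ContDiff ℝ ∞ φ) {a b : ℝ}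
    (ha : 0 < a) (h : tsupport φ ⊆ Icc a b) (k : ℕ) {w : ℝ → ℝ} (hw : Continuous w)
    (hneg : ∫ t in Ioi (0 : ℝ), (‖deriv φ t‖ ^ 2 + w t * ‖φ t‖ ^ 2) < 0) :
    ∀ᶠ ε in 𝓝 (0 : ℝ), ∫ t in Icc a b, rescaledDensity φ k w ε t < 0 := by
  have hd : Continuous (deriv φ) := hφ.continuous_deriv (by simp)
  have hc : Continuous (Function.uncurry (rescaledDensity φ k w)) := by
    have h1 : Continuous fun p : ℝ × ℝ => φ p.2 := hφ.continuous.comp continuous_snd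
    have h2 : Continuous fun p : ℝ × ℝ => deriv φ p.2 := hd.comp continuous_snd
    have h3 : Continuous fun p : ℝ × ℝ => w p.2 := hw.comp continuous_snd
    have h4 : Continuous fun p : ℝ × ℝ => (inner ℝ (φ p.2) (deriv φ p.2) : ℝ) := h1.inner h2
    simp only [Function.uncurry_def, rescaledDensity]
    fun_prop
  have hcont : Continuous fun ε => ∫ t in Icc a b, rescaledDensity φ k w ε t :=
    continuous_parametric_integral_of_continuous hc isCompact_Icc
  refine (hcont.tendsto 0).eventually (gt_mem_nhds (lt_of_eq_of_lt ?_ hneg))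
  have e : ∀ t, rescaledDensity φ k w 0 t = ‖deriv φ t‖ ^ 2 + w t * ‖φ t‖ ^ 2 := fun t => by
    simp [rescaledDensity]
  have hz : ∀ t ∉ Icc a b, ‖deriv φ t‖ ^ 2 + w t * ‖φ t‖ ^ 2 = 0 := fun t ht => by
    rw [← e]
    exact rescaledDensity_eq_zero h k w 0 ht
  simp only [e]
  rw [setIntegral_eq_integral_of_forall_compl_eq_zero hz,
    setIntegral_eq_integral_of_forall_compl_eq_zero fun t ht => ?_]
  refine hz t fun h1 => ht ?_
  exact lt_of_lt_of_le ha h1.1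

end TrialEnergy

/-! ### Negative energy in every sector, and small resolvents. -/

namespace HalfLinePotential

/-- If the half-line operator has a negative eigenvalue, then the scaled operators on the disk are
not bounded below by a positive constant on any given angular momentum sector. -/
lemma HasNegativeEigenvalue.eventually_not_boundedBelow {V : HalfLinePotential}
    (hV : V.HasNegativeEigenvalue) (k : ℕ) :
    ∀ᶠ ε in comap (fun ε : Ioi (0 : ℝ) => (ε : ℝ)) (𝓝 0),
      ¬ V.BoundedBelow (Real.pi / ((k + 1 : ℕ) : ℝ)) ε := by
  obtain ⟨φ, hneg⟩ := hV.exists_test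
  obtain ⟨a, b, ha, hb, hab⟩ := exists_support_bounds φ
  have hw := V.continuous_comp_max
  have hneg' : ∫ t in Ioi (0 : ℝ), (‖deriv φ t‖ ^ 2 + V (max t 0) * ‖φ t‖ ^ 2) < 0 := by
    refine lt_of_eq_of_lt (setIntegral_congr_fun measurableSet_Ioi fun t ht => ?_) hneg
    have ht' : (0 : ℝ) ≤ t := le_of_lt (mem_Ioi.1 ht)
    simp only [max_eq_left ht']
  have h1 := eventually_integral_rescaledDensity_neg φ.contDiff ha hab k hw hneg'
  have h2 : ∀ᶠ ε in 𝓝 (0 : ℝ), ε * b < 1 :=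
    ((continuous_id.mul continuous_const).tendsto (0 : ℝ)).eventually
      (gt_mem_nhds (by simp))
  refine ((h1.and h2).comap _).mono fun ε ⟨h3, h4⟩ hbdd => ?_
  have hε : (0 : ℝ) < ε := ε.2
  set ψ := trialTest φ hab ha (k + 1) hε h4 with hψ
  have hdom : testL2 ψ ∈ (V.diskOperator ε).domain :=
    V.mem_diskOperator_domain.2 ⟨testL2_mem_sobolevH10 _ _, testL2_mem_sobolevH2 _ _⟩
  have h5 := hbdd ⟨testL2 ψ, hdom⟩ (testL2_trialTest_mem φ hab ha (Nat.succ_ne_zero k) hε h4)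
  rw [V.inner_diskOperator] at h5
  have hW : V.scaledPotential ε =ᵐ[volume.restrict (unitDisk : Set Plane)]
      fun x => ((1 / (ε : ℝ) ^ 2 * V (max ((1 - ‖x‖) / (ε : ℝ)) 0) : ℝ) : ℂ) := by
    filter_upwards [V.coeFn_scaledPotential ε, ae_restrict_mem unitDisk.isOpen.measurableSet]
      with x h₁ h₂
    have hx1 : ‖x‖ < 1 := by simpa [unitDisk] using h₂
    rw [h₁, max_eq_left (div_nonneg (by linarith) hε.le)]
  have h6 := form_testL2 (e := planeFrame) hW ψ
  have h7 := integral_energy_trialFun (φ.contDiff.differentiable (by simp)) ha hab k hε h4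
    (fun t => V (max t 0))
  simp only [weakDeriv_testL2] at h5
  -- The lower bound would place ‖ψ‖² ≥ 0 below a negative energy.
  have h8 := h5.trans (h6.trans h7).le
  have h9 : (0 : ℝ) ≤ ‖testL2 ψ‖ ^ 2 := sq_nonneg _
  have hvol : 0 < (volume : Measure Plane).real (ball 0 1) :=
    ENNReal.toReal_pos (measure_ball_pos _ _ one_pos).ne' measure_ball_lt_top.ne
  have h10 : 2 * (volume : Measure Plane).real (ball 0 1)
      * ((ε : ℝ)⁻¹ * ∫ t in Icc a b, rescaledDensity φ k (fun t => V (max t 0)) ε t) < 0 :=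
    mul_neg_of_pos_of_neg (by positivity) (mul_neg_of_pos_of_neg (inv_pos.2 hε) h3)
  linarith

/-- Resolvents close to the resolvent of the Robin Laplacian are small on the functions that change
sign under rotations by a small angle. -/
lemma norm_resolvent_le {V : HalfLinePotential} {ε : Ioi (0 : ℝ)}
    {R S : L2 unitDisk →L[ℂ] L2 unitDisk} (hR : IsResolventAt (V.diskOperator ε) Complex.I R)
    (hS : ∀ f, S f ∈ robinDomain) (hRS : ‖R - S‖ ≤ 1 / 4) {C s : ℝ} (hs : 0 ≤ s)
    (hC : ∀ f, √(∑ i, ‖weakDeriv unitDisk (planeFrame i) (S f)‖ ^ 2) ≤ C * ‖f‖)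
    (hsC : s * C ≤ 1 / 2) {f : L2 unitDisk} (hf : f ∈ antiInvariant s) :
    ‖R f‖ ≤ 1 / 2 * ‖f‖ := by
  have hg := V.resolvent_mem_antiInvariant hR s hf
  have h1 := norm_inner_le_of_mem_antiInvariant hs hg (jet_mem_closure_of_mem_robinDomain (hS f))
  have h2 : ‖⟪R f, (R - S) f⟫_ℂ‖ ≤ ‖R f‖ * (1 / 4 * ‖f‖) :=
    (norm_inner_le_norm _ _).trans (mul_le_mul_of_nonneg_left
      (((R - S).le_opNorm f).trans (mul_le_mul_of_nonneg_right hRS (norm_nonneg _))) (norm_nonneg _))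
  -- Both terms are at most ‖R f‖‖f‖/4: the first by closeness of the resolvents, the second by
  -- testing S f against R f, which lies in the sector.
  have h3 : ‖R f‖ ^ 2 = ‖⟪R f, (R - S) f⟫_ℂ + ⟪R f, S f⟫_ℂ‖ := by
    rw [← inner_add_right, sub_apply, sub_add_cancel, inner_self_eq_norm_sq_to_K]
    simp
  have h4 : s * ‖R f‖ * √(∑ i, ‖weakDeriv unitDisk (planeFrame i) (S f)‖ ^ 2)
      ≤ ‖R f‖ * (1 / 2 * ‖f‖) := by
    calc s * ‖R f‖ * √(∑ i, ‖weakDeriv unitDisk (planeFrame i) (S f)‖ ^ 2)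
        ≤ s * ‖R f‖ * (C * ‖f‖) := mul_le_mul_of_nonneg_left (hC f) (by positivity)
      _ = (s * C) * (‖R f‖ * ‖f‖) := by ring
      _ ≤ 1 / 2 * (‖R f‖ * ‖f‖) := mul_le_mul_of_nonneg_right hsC (by positivity)
      _ = _ := by ring
  have h5 : ‖R f‖ * ‖R f‖ ≤ ‖R f‖ * (1 / 2 * ‖f‖) := by
    rw [← sq, h3]
    refine (norm_add_le _ _).trans ?_
    linarith
  rcases (norm_nonneg (R f)).eq_or_lt with h0 | h0
  · rw [← h0]
    positivity
  · exact le_of_mul_le_mul_left h5 h0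

end HalfLinePotential

end

/-! ### The contradiction. -/

theorem proposition5p3 (V : HalfLinePotential) (hV : V.IsResonant)
    (hneg : V.HasNegativeEigenvalue) :
    ¬ NormResolventTendsto (fun ε : Set.Ioi (0 : ℝ) => V.diskOperator ε)
      (Filter.comap (fun ε : Set.Ioi (0 : ℝ) => (ε : ℝ)) (nhds 0)) robinLaplacian := by
  rintro ⟨R, S, hR, hS, hRS⟩
  have hSdom : ∀ f, S f ∈ robinDomain := fun f => (hS.1 f).1
  obtain ⟨C, hC0, hC⟩ := exists_jet_bound (S := S) fun f => (hSdom f).1.1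
  have hsmall : ∀ᶠ ε in comap (fun ε : Ioi (0 : ℝ) => (ε : ℝ)) (𝓝 0), ‖R ε - S‖ ≤ 1 / 4 :=
    hRS.eventually (ge_mem_nhds (by norm_num))
  obtain ⟨U, hU, hUsub⟩ := mem_comap.1 (hR.and hsmall)
  obtain ⟨δ, hδ, hball⟩ := Metric.mem_nhds_iff.1 hU
  have hgood : ∀ ε : Ioi (0 : ℝ), (ε : ℝ) < δ →
      IsResolventAt (V.diskOperator ε) Complex.I (R ε) ∧ ‖R ε - S‖ ≤ 1 / 4 := by
    intro ε hε
    refine hUsub (hball ?_)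
    rw [mem_ball, Real.dist_eq, sub_zero, abs_of_pos ε.2]
    exact hε
  -- The order of choices matters: ε₀ is fixed first, from norm convergence alone; then k is taken
  -- large in terms of C and the potential at ε₀.
  let ε₀ : Ioi (0 : ℝ) := ⟨δ / 2, half_pos hδ⟩
  have hlt (ε : Ioi (0 : ℝ)) (h : ε ≤ ε₀) : (ε : ℝ) < δ := lt_of_le_of_lt h (half_lt_self hδ)
  have hlim : Tendsto (fun k : ℕ => Real.pi / ((k + 1 : ℕ) : ℝ)) atTop (𝓝 0) :=
    (tendsto_const_div_atTop_nhds_zero_nat Real.pi).comp (tendsto_add_atTop_nat 1)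
  have h1 : ∀ᶠ k : ℕ in atTop, Real.pi / ((k + 1 : ℕ) : ℝ) * C ≤ 1 / 2 := by
    have h := hlim.mul_const C
    rw [zero_mul] at h
    exact h.eventually (ge_mem_nhds (by norm_num))
  have h2 : ∀ᶠ k : ℕ in atTop,
      (Real.pi / ((k + 1 : ℕ) : ℝ)) ^ 2 * (‖V.scaledPotential ε₀‖ + 1) ≤ 4 := by
    have h := (hlim.pow 2).mul_const (‖V.scaledPotential ε₀‖ + 1)
    rw [zero_pow two_ne_zero, zero_mul] at h
    exact h.eventually (ge_mem_nhds (by norm_num))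
  obtain ⟨k, hk1, hk2⟩ := (h1.and h2).exists
  have hs : 0 < Real.pi / ((k + 1 : ℕ) : ℝ) := by positivity
  have hbdd : ∀ ε ≤ ε₀, V.BoundedBelow (Real.pi / ((k + 1 : ℕ) : ℝ)) ε := fun ε hε =>
    V.boundedBelow_of_le (V.boundedBelow_of_small_angle hs ε₀ hk2)
      (fun η hη => (hgood η (hlt η hη)).1)
      (fun η hη f hf => HalfLinePotential.norm_resolvent_le (hgood η (hlt η hη)).1 hSdom
        (hgood η (hlt η hη)).2 hs.le hC hk1 hf) hε
  -- Only now, with the sector k fixed, is ε taken small enough for the trial function to have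
  -- negative energy.
  obtain ⟨U', hU', hUsub'⟩ := mem_comap.1 (hneg.eventually_not_boundedBelow k)
  obtain ⟨δ', hδ', hball'⟩ := Metric.mem_nhds_iff.1 hU'
  let ε : Ioi (0 : ℝ) := ⟨min (δ / 2) (δ' / 2), lt_min (half_pos hδ) (half_pos hδ')⟩
  have hε : ε ≤ ε₀ := Subtype.coe_le_coe.1 (min_le_left _ _)
  refine hUsub' (a := ε) (hball' ?_) (hbdd ε hε)
  rw [mem_ball, Real.dist_eq, sub_zero, abs_of_pos ε.2]
  exact lt_of_le_of_lt (min_le_right _ _) (half_lt_self hδ')
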